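/- Let $n\ge 1$ and $p\ge 2$ be integers and let $q$ be an integer coprime to $p$. Write $[X,Y]$ for the set of homotopy classes of continuous maps $X\to Y$. Let $L(p,q)$ be the lens space, the orbit space of $S^3\subset\mathbb{C}^2$ under the action of $\mathbb{Z}/p\mathbb{Z}$ generated by $(z_0,z_1)\mapsto(e^{2\pi i/p}z_0,e^{2\pi iq/p}z_1)$. Let $P^2(p)=S^1\cup_{z\mapsto z^p}D^2$ be the mod-$p$ Moore space (the mapping cone of the degree $p$ map of $S^1$), let $i\colon P^2(p)\to L(p,q)$, $[z]\mapsto[(z,\sqrt{1-|z|^2})]$, be the inclusion of the $2$-skeleton, and let $\pi\colon P^2(p)\to P^2(p)/S^1\cong S^2$ be the pinch map to the top cell. For $X\in\{S^2,P^2(p),L(p,q)\}$ the set $[X,BU(n)]$ is given the following addition. If $n=1$, it is that of $[X,K(\mathbb{Z},2)]$, that is, the tensor product of line bundles. If $n\ge2$, it is the one induced from $[X,BU(\infty)]$ by stabilization: $\gamma=\alpha+\beta$ if and only if $\alpha\oplus\beta$ and $\gamma\oplus\varepsilon^n$ become equal in $[X,BU(2n+k)]$ after adding the trivial bundle $\varepsilon^k$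 for some $k\ge0$. Then these are abelian group structures, $[S^2,BU(n)]\cong\mathbb{Z}$, and: (a) there is a group isomorphism $[P^2(p),BU(n)]\cong\mathbb{Z}/p\mathbb{Z}$; (b) under these isomorphisms, $\pi^*\colon[S^2,BU(n)]\to[P^2(p),BU(n)]$ is the reduction $\mathbb{Z}\to\mathbb{Z}/p\mathbb{Z}$ mod $p$; (c) $i^*\colon[L(p,q),BU(n)]\to[P^2(p),BU(n)]$ is a group isomorphism; (d) there is a map $\overline{\pi}\colon L(p,q)\to S^2$ with $\overline{\pi}\circ i=\pi$, and for every map $\overline{\pi}\colon L(p,q)\to S^2$ with $\overline{\pi}\circ i\simeq\pi$ the map $\overline{\pi}^*\colon[S^2,BU(n)]\to[L(p,q),BU(n)]$ is, under the isomorphisms of (a) and (c), reduction mod $p$. -/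

import Mathlib

/-! ### Homotopy classes of maps -/

/-- Homotopy of continuous maps, as a setoid. -/
def homotopySetoid (X Y : Type) [TopologicalSpace X] [TopologicalSpace Y] : Setoid C(X, Y) :=
  ⟨ContinuousMap.Homotopic, ContinuousMap.Homotopic.equivalence⟩

/-- The set `[X, Y]` of homotopy classes of continuous maps `X → Y`. -/
def HtpyClasses (X Y : Type) [TopologicalSpace X] [TopologicalSpace Y] : Type :=
  Quotient (homotopySetoid X Y)

/-- The homotopy class of a map. -/
def htpyClass {X Y : Type} [TopologicalSpace X] [TopologicalSpace Y] (f : C(X, Y)) :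
    HtpyClasses X Y :=
  Quotient.mk (homotopySetoid X Y) f

/-- The induced map `g^* : [Y, Z] → [X, Z]`, `[f] ↦ [f ∘ g]`. -/
def htpyPullback {X Y : Type} (Z : Type) [TopologicalSpace X] [TopologicalSpace Y]
    [TopologicalSpace Z] (g : C(X, Y)) : HtpyClasses Y Z → HtpyClasses X Z :=
  Quotient.map (fun f => f.comp g)
    (fun _ _ h => ContinuousMap.Homotopic.comp h (ContinuousMap.Homotopic.refl g))

/-! ### The classifying space `BU(n)` and sums of bundles -/

/-- The complex Hilbert space `ℓ²(ℕ)`. -/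
abbrev EllTwo : Type := lp (fun _ : ℕ => ℂ) 2

/-- `BU(n)` as the Grassmannian of `n`-dimensional complex subspaces of `ℓ²(ℕ)`, a subspace being
identified with the orthogonal projection onto it, with the norm topology. It is the quotient of
the (contractible) space of isometries `ℂⁿ → ℓ²(ℕ)` by the free action of `U(n)`. -/
abbrev BU (n : ℕ) : Type :=
  {P : EllTwo →L[ℂ] EllTwo // IsStarProjection P ∧ Module.rank ℂ P.range = n}

/-- The standard Hilbert basis of `ℓ²(ℕ)`. -/
noncomputable def ellBasis : HilbertBasis ℕ ℂ EllTwo :=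
  HilbertBasis.ofRepr (LinearIsometryEquiv.refl ℂ EllTwo)

/-- The isometry of `ℓ²(ℕ)` taking the basis vector `e i` to `e (φ i)`, for injective `φ`. -/
noncomputable def ellEmb (φ : ℕ → ℕ) (hφ : Function.Injective φ) : EllTwo →ₗᵢ[ℂ] EllTwo :=
  (ellBasis.orthonormal.comp φ hφ).orthogonalFamily.linearIsometry

theorem ellEmb_inner_zero (φ ψ : ℕ → ℕ) (hφ : Function.Injective φ) (hψ : Function.Injective ψ)
    (h : ∀ i j, φ i ≠ ψ j) (u w : EllTwo) : inner ℂ (ellEmb φ hφ u) (ellEmb ψ hψ w) = 0 := by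
  have key : ∀ (j : ℕ) (c : ℂ), inner ℂ (ellEmb φ hφ u) (c • ellBasis (ψ j)) = 0 := by
    intro j c
    have h1 := (ellBasis.orthonormal.comp φ hφ).orthogonalFamily.hasSum_linearIsometry u
    have h2 := h1.mapL (innerSL ℂ (c • ellBasis (ψ j)))
    have h3 : inner ℂ (c • ellBasis (ψ j)) (ellEmb φ hφ u) = 0 := by
      refine h2.unique ?_
      convert hasSum_zero with i
      simp [ellBasis.orthonormal.2 (h i j).symm]
    exact inner_eq_zero_symm.1 h3
  have h1 := (ellBasis.orthonormal.comp ψ hψ).orthogonalFamily.hasSum_linearIsometry w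
  have h2 := h1.mapL (innerSL ℂ (ellEmb φ hφ u))
  refine h2.unique ?_
  convert hasSum_zero with i
  simpa using key i (w i)

/-- The isometry `e i ↦ e (2 i)`. -/
noncomputable def evenEmb : EllTwo →ₗᵢ[ℂ] EllTwo :=
  ellEmb (fun i => 2 * i) (fun a b h => by simpa using h)

/-- The isometry `e i ↦ e (2 i + 1)`. -/
noncomputable def oddEmb : EllTwo →ₗᵢ[ℂ] EllTwo :=
  ellEmb (fun i => 2 * i + 1) (fun a b h => by simpa using h)

/-- The block sum `P ⊕ Q` of two operators, along `ℓ²(ℕ) ⊕ ℓ²(ℕ) ≅ ℓ²(ℕ)`, `(u, w) ↦ even u + odd w`. -/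
noncomputable def blockSum (P Q : EllTwo →L[ℂ] EllTwo) : EllTwo →L[ℂ] EllTwo :=
  evenEmb.toContinuousLinearMap ∘L P ∘L evenEmb.toContinuousLinearMap.adjoint +
    oddEmb.toContinuousLinearMap ∘L Q ∘L oddEmb.toContinuousLinearMap.adjoint

theorem evenEmb_adjoint_even (u : EllTwo) :
    evenEmb.toContinuousLinearMap.adjoint (evenEmb u) = u := by
  refine ext_inner_left ℂ fun v => ?_
  rw [ContinuousLinearMap.adjoint_inner_right]
  exact evenEmb.inner_map_map v u

theorem oddEmb_adjoint_odd (u : EllTwo) :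
    oddEmb.toContinuousLinearMap.adjoint (oddEmb u) = u := by
  refine ext_inner_left ℂ fun v => ?_
  rw [ContinuousLinearMap.adjoint_inner_right]
  exact oddEmb.inner_map_map v u

theorem evenEmb_adjoint_odd (u : EllTwo) :
    evenEmb.toContinuousLinearMap.adjoint (oddEmb u) = 0 := by
  refine ext_inner_left ℂ fun v => ?_
  rw [ContinuousLinearMap.adjoint_inner_right, inner_zero_right]
  exact ellEmb_inner_zero (fun i => 2 * i) (fun i => 2 * i + 1) (fun a b h => by simpa using h)
    (fun a b h => by simpa using h) (fun i j => by omega) v u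

theorem oddEmb_adjoint_even (u : EllTwo) :
    oddEmb.toContinuousLinearMap.adjoint (evenEmb u) = 0 := by
  refine ext_inner_left ℂ fun v => ?_
  rw [ContinuousLinearMap.adjoint_inner_right, inner_zero_right]
  exact ellEmb_inner_zero (fun i => 2 * i + 1) (fun i => 2 * i) (fun a b h => by simpa using h)
    (fun a b h => by simpa using h) (fun i j => by omega) v u

theorem blockSum_apply (P Q : EllTwo →L[ℂ] EllTwo) (u : EllTwo) :
    blockSum P Q u = evenEmb (P (evenEmb.toContinuousLinearMap.adjoint u)) +
      oddEmb (Q (oddEmb.toContinuousLinearMap.adjoint u)) := rfl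

theorem blockSum_isStarProjection {P Q : EllTwo →L[ℂ] EllTwo} (hP : IsStarProjection P)
    (hQ : IsStarProjection Q) : IsStarProjection (blockSum P Q) := by
  constructor
  · ext1 u
    have h1 : ∀ v, P (P v) = P v := fun v => congrArg (fun T => T v) hP.isIdempotentElem.eq
    have h2 : ∀ v, Q (Q v) = Q v := fun v => congrArg (fun T => T v) hQ.isIdempotentElem.eq
    rw [mul_apply_eq_comp, blockSum_apply P Q (blockSum P Q u), blockSum_apply P Q u]
    simp only [map_add, evenEmb_adjoint_even, evenEmb_adjoint_odd, oddEmb_adjoint_even,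
      oddEmb_adjoint_odd, h1, h2, add_zero, zero_add]
  · have hp : P.adjoint = P := hP.isSelfAdjoint.star_eq
    have hq : Q.adjoint = Q := hQ.isSelfAdjoint.star_eq
    rw [IsSelfAdjoint, ContinuousLinearMap.star_eq_adjoint, blockSum]
    simp only [map_add, ContinuousLinearMap.adjoint_comp, ContinuousLinearMap.adjoint_adjoint, hp,
      hq, ContinuousLinearMap.comp_assoc]

theorem blockSum_rank {P Q : EllTwo →L[ℂ] EllTwo} :
    Module.rank ℂ (blockSum P Q).range =
      Module.rank ℂ P.range + Module.rank ℂ Q.range := by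
  let T : (P.range × Q.range) →ₗ[ℂ] EllTwo :=
    (evenEmb.toLinearMap ∘ₗ P.range.subtype).coprod
      (oddEmb.toLinearMap ∘ₗ Q.range.subtype)
  have hT : ∀ x, T x = evenEmb x.1 + oddEmb x.2 := fun x => rfl
  have hinj : Function.Injective T := by
    intro x y hxy
    rw [hT, hT] at hxy
    have h1 := congrArg evenEmb.toContinuousLinearMap.adjoint hxy
    have h2 := congrArg oddEmb.toContinuousLinearMap.adjoint hxy
    simp only [map_add, evenEmb_adjoint_even, evenEmb_adjoint_odd, oddEmb_adjoint_even,
      oddEmb_adjoint_odd, add_zero, zero_add] at h1 h2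
    exact Prod.ext (Subtype.ext h1) (Subtype.ext h2)
  have hr : LinearMap.range T = (blockSum P Q).range := by
    ext v
    constructor
    · rintro ⟨⟨⟨_, a, rfl⟩, ⟨_, b, rfl⟩⟩, rfl⟩
      refine ⟨evenEmb a + oddEmb b, ?_⟩
      change blockSum P Q _ = _
      rw [blockSum_apply, hT]
      simp only [map_add, evenEmb_adjoint_even, evenEmb_adjoint_odd, oddEmb_adjoint_even,
        oddEmb_adjoint_odd, add_zero, zero_add]
      rfl
    · rintro ⟨u, rfl⟩
      exact ⟨(⟨_, _, rfl⟩, ⟨_, _, rfl⟩), rfl⟩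
  rw [← hr, ← (LinearEquiv.ofInjective T hinj).rank_eq, rank_prod']

theorem continuous_blockSum :
    Continuous fun x : (EllTwo →L[ℂ] EllTwo) × (EllTwo →L[ℂ] EllTwo) => blockSum x.1 x.2 := by
  unfold blockSum
  fun_prop

/-- The Whitney sum map `BU(m) × BU(n) → BU(m + n)`. -/
noncomputable def whitneySum (m n : ℕ) : C(BU m × BU n, BU (m + n)) where
  toFun x := ⟨blockSum x.1.1 x.2.1, blockSum_isStarProjection x.1.2.1 x.2.2.1, by
    rw [blockSum_rank, x.1.2.2, x.2.2.2, Nat.cast_add]⟩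
  continuous_toFun := Continuous.subtype_mk (continuous_blockSum.comp
    ((continuous_subtype_val.comp continuous_fst).prodMk
      (continuous_subtype_val.comp continuous_snd))) _

/-- The Whitney sum of homotopy classes, `[X, BU(m)] × [X, BU(n)] → [X, BU(m + n)]`. -/
noncomputable def classSum {X : Type} [TopologicalSpace X] {m n : ℕ} :
    HtpyClasses X (BU m) → HtpyClasses X (BU n) → HtpyClasses X (BU (m + n)) :=
  Quotient.map₂ (fun f g => (whitneySum m n).comp (f.prodMk g))
    (fun _ _ h _ _ h' =>
      ContinuousMap.Homotopic.comp (ContinuousMap.Homotopic.refl _) (h.prodMk h'))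

instance ellSpan_finite (n : ℕ) :
    FiniteDimensional ℂ (Submodule.span ℂ (Set.range fun i : Fin n => ellBasis i)) :=
  FiniteDimensional.span_of_finite ℂ (Set.finite_range _)

/-- The point of `BU(n)` given by the span of the first `n` basis vectors. -/
noncomputable def basePointBU (n : ℕ) : BU n :=
  ⟨(Submodule.span ℂ (Set.range fun i : Fin n => ellBasis i)).starProjection,
    isStarProjection_starProjection, by
      have h : LinearIndependent ℂ fun i : Fin n => ellBasis i :=
        (ellBasis.orthonormal.comp (fun i : Fin n => (i : ℕ)) Fin.val_injective).linearIndependent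
      rw [Submodule.range_starProjection, rank_span h, Cardinal.mk_range_eq _ h.injective,
        Cardinal.mk_fin]⟩

/-- The class in `[X, BU(n)]` of the trivial bundle of rank `n`. -/
noncomputable def trivialClass (X : Type) [TopologicalSpace X] (n : ℕ) : HtpyClasses X (BU n) :=
  htpyClass (ContinuousMap.const X (basePointBU n))

/-- `γ` is the sum of `α` and `β` after stabilization: the classes `α ⊕ β` and `γ ⊕ n` in
`[X, BU(2n)]` become equal in some `[X, BU(2n + k)]`. For compact `X` this says that their images
in `[X, BU(∞)] = colim [X, BU(N)]` satisfy `α + β = γ` for the Whitney sum. -/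
def IsStableSum {X : Type} [TopologicalSpace X] {n : ℕ} (α β γ : HtpyClasses X (BU n)) : Prop :=
  ∃ k : ℕ, classSum (classSum α β) (trivialClass X k) =
    classSum (classSum γ (trivialClass X n)) (trivialClass X k)

/-- The line bundle classified by `h` is isomorphic to the tensor product of those classified by
`f` and `g`: there is a continuous family of bilinear maps which over every `x` restricts to a
nonzero pairing `f x ⊗ g x → h x` of lines. -/
def IsTensorMap {X : Type} [TopologicalSpace X] (f g h : C(X, BU 1)) : Prop :=
  ∃ B : C(X, EllTwo →L[ℂ] EllTwo →L[ℂ] EllTwo), ∀ x : X,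
    ∀ u ∈ (f x).1.range, ∀ w ∈ (g x).1.range,
      B x u w ∈ (h x).1.range ∧ (u ≠ 0 → w ≠ 0 → B x u w ≠ 0)

/-- `γ = α ⊗ β` in `[X, BU(1)]`; this is the addition of `H²(X; ℤ)` on `[X, K(ℤ, 2)]`. -/
def IsTensorProd {X : Type} [TopologicalSpace X] (α β γ : HtpyClasses X (BU 1)) : Prop :=
  ∃ f g h : C(X, BU 1), htpyClass f = α ∧ htpyClass g = β ∧ htpyClass h = γ ∧ IsTensorMap f g h

/-- The relation `γ = α + β` of the group `[X, BU(n)]`: for `n = 1` the group structure is that of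
`[X, K(ℤ, 2)]`, for `n ≠ 1` it is the one coming from `[X, BU(∞)]`. -/
def IsClassAdd {X : Type} [TopologicalSpace X] :
    (n : ℕ) → HtpyClasses X (BU n) → HtpyClasses X (BU n) → HtpyClasses X (BU n) → Prop
  | 1 => IsTensorProd
  | _ => IsStableSum

/-- The given group structure on `[X, BU(n)]` is the one described above (at most one is). -/
def IsBundleGroup (X : Type) [TopologicalSpace X] (n : ℕ)
    [AddCommGroup (HtpyClasses X (BU n))] : Prop :=
  ∀ α β γ : HtpyClasses X (BU n), γ = α + β ↔ IsClassAdd n α β γ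

/-! ### The sphere, the Moore space, the lens space and the maps between them -/

/-- The sphere `S²`. -/
abbrev SphereTwo : Type := Metric.sphere (0 : EuclideanSpace ℝ (Fin 3)) 1

/-- The sphere `S³ ⊆ ℂ²`. -/
abbrev SphereThree : Type := Metric.sphere (0 : EuclideanSpace ℂ (Fin 2)) 1

/-- The closed unit disc `D² ⊆ ℂ`, the cone on `S¹`. -/
abbrev DiscTwo : Type := Metric.closedBall (0 : ℂ) 1

/-- Boundary points of the disc with the same image under `z ↦ z ^ p` are identified. -/
def mooreSetoid (p : ℕ) : Setoid DiscTwo where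
  r z w := z = w ∨ (‖z.1‖ = 1 ∧ ‖w.1‖ = 1 ∧ z.1 ^ p = w.1 ^ p)
  iseqv :=
    { refl := fun _ => Or.inl rfl
      symm := by
        rintro z w (h | ⟨h1, h2, h3⟩)
        · exact Or.inl h.symm
        · exact Or.inr ⟨h2, h1, h3.symm⟩
      trans := by
        rintro z w v (rfl | ⟨h1, h2, h3⟩) (rfl | ⟨h4, h5, h6⟩)
        · exact Or.inl rfl
        · exact Or.inr ⟨h4, h5, h6⟩
        · exact Or.inr ⟨h1, h2, h3⟩
        · exact Or.inr ⟨h1, h5, h3.trans h6⟩ }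

/-- The Moore space `P²(p) = S¹ ∪ D²`, the mapping cone of the degree `p` map `z ↦ z ^ p` of `S¹`. -/
abbrev MooreSpace (p : ℕ) : Type := Quotient (mooreSetoid p)

/-- The orbit relation on `S³` of the action of `ℤ/p` generated by
`(z₀, z₁) ↦ (e^{2πi/p} z₀, e^{2πiq/p} z₁)`. -/
def lensSetoid (p : ℕ) (q : ℤ) : Setoid SphereThree where
  r x y := ∃ k : ℤ, y.1 0 = Complex.exp (2 * Real.pi * Complex.I * k / p) * x.1 0 ∧
    y.1 1 = Complex.exp (2 * Real.pi * Complex.I * (q * k) / p) * x.1 1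
  iseqv :=
    { refl := fun _ => ⟨0, by simp, by simp⟩
      symm := by
        rintro x y ⟨k, h0, h1⟩
        refine ⟨-k, ?_, ?_⟩
        · rw [h0, ← mul_assoc, ← Complex.exp_add]
          simp only [Int.cast_neg, mul_neg, neg_div, neg_add_cancel, Complex.exp_zero, one_mul]
        · rw [h1, ← mul_assoc, ← Complex.exp_add]
          simp only [Int.cast_neg, mul_neg, neg_div, neg_add_cancel, Complex.exp_zero, one_mul]
      trans := by
        rintro x y z ⟨k, h0, h1⟩ ⟨l, h2, h3⟩
        refine ⟨l + k, ?_, ?_⟩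
        · rw [h2, h0, ← mul_assoc, ← Complex.exp_add]
          simp only [Int.cast_add, mul_add, add_div]
        · rw [h3, h1, ← mul_assoc, ← Complex.exp_add]
          simp only [Int.cast_add, mul_add, add_div] }

/-- The lens space `L(p, q) = S³ / (ℤ/p)`. -/
abbrev LensSpace (p : ℕ) (q : ℤ) : Type := Quotient (lensSetoid p q)

theorem DiscTwo.norm_le (z : DiscTwo) : ‖z.1‖ ≤ 1 :=
  mem_closedBall_zero_iff.1 z.2

theorem DiscTwo.sq_sqrt (z : DiscTwo) : Real.sqrt (1 - ‖z.1‖ ^ 2) ^ 2 = 1 - ‖z.1‖ ^ 2 :=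
  Real.sq_sqrt (by nlinarith [z.norm_le, norm_nonneg z.1])

/-- The disc `z ↦ (z, √(1 - |z|²))` in `S³`. -/
noncomputable def discToSphereThree : C(DiscTwo, SphereThree) where
  toFun z := ⟨!₂[z.1, (Real.sqrt (1 - ‖z.1‖ ^ 2) : ℂ)], by
    simp [EuclideanSpace.norm_eq, DiscTwo.sq_sqrt]⟩
  continuous_toFun := by
    refine Continuous.subtype_mk ?_ _
    refine (PiLp.continuous_toLp 2 _).comp (continuous_pi fun i => ?_)
    fin_cases i
    · exact continuous_subtype_val
    · exact Complex.continuous_ofReal.comp (by fun_prop)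

/-- The inclusion `i : P²(p) → L(p, q)` of the `2`-skeleton, `[z] ↦ [(z, √(1 - |z|²))]`. Its image
is the set of orbits of points with `z₁ = 0` or `z₁ ^ p > 0`; the complement is one open `3`-cell,
the image of `{z₁ ≠ 0, 0 < arg z₁ < 2π/p}`. -/
noncomputable def skeletonIncl (p : ℕ) (q : ℤ) (hp : 2 ≤ p) : C(MooreSpace p, LensSpace p q) where
  toFun := Quotient.map discToSphereThree (by
    rintro z w (rfl | ⟨hz, hw, h⟩)
    · exact (lensSetoid p q).refl _
    · have hz0 : z.1 ≠ 0 := fun h0 => by simp [h0] at hz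
      have : NeZero p := ⟨by omega⟩
      have hζ : (w.1 / z.1) ^ p = 1 := by
        rw [div_pow, ← h, div_self (pow_ne_zero _ hz0)]
      obtain ⟨k, -, hk⟩ := (Complex.isPrimitiveRoot_exp p (NeZero.ne p)).eq_pow_of_pow_eq_one hζ
      refine ⟨k, ?_, ?_⟩
      · change w.1 = _ * z.1
        rw [eq_comm, ← eq_div_iff hz0, ← hk, ← Complex.exp_nat_mul]
        congr 1
        push_cast
        ring
      · simp [discToSphereThree, hz, hw])
  continuous_toFun := Continuous.quotient_map' discToSphereThree.continuous _

/-- The map `D² → S²`, `z ↦ (2 √(1 - |z|²) z, 2|z|² - 1)`, which collapses the boundary circle to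
the north pole and is injective on the interior. -/
noncomputable def discToSphereTwo : C(DiscTwo, SphereTwo) where
  toFun z := ⟨!₂[2 * Real.sqrt (1 - ‖z.1‖ ^ 2) * z.1.re, 2 * Real.sqrt (1 - ‖z.1‖ ^ 2) * z.1.im,
      2 * ‖z.1‖ ^ 2 - 1], by
    have h1 := z.sq_sqrt
    have h2 : ‖z.1‖ ^ 2 = z.1.re ^ 2 + z.1.im ^ 2 := by
      rw [Complex.sq_norm, Complex.normSq_apply]; ring
    rw [mem_sphere_zero_iff_norm, EuclideanSpace.norm_eq, Real.sqrt_eq_one, Fin.sum_univ_three]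
    simp only [Real.norm_eq_abs, sq_abs]
    change (2 * Real.sqrt (1 - ‖z.1‖ ^ 2) * z.1.re) ^ 2 +
      (2 * Real.sqrt (1 - ‖z.1‖ ^ 2) * z.1.im) ^ 2 + (2 * ‖z.1‖ ^ 2 - 1) ^ 2 = 1
    rw [mul_pow, mul_pow, mul_pow, mul_pow, h1, h2]
    ring⟩
  continuous_toFun := by
    refine Continuous.subtype_mk ?_ _
    refine (PiLp.continuous_toLp 2 _).comp (continuous_pi fun i => ?_)
    have h1 : Continuous fun z : DiscTwo => z.1.re :=
      Complex.continuous_re.comp continuous_subtype_val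
    have h2 : Continuous fun z : DiscTwo => z.1.im :=
      Complex.continuous_im.comp continuous_subtype_val
    fin_cases i
    · change Continuous fun z : DiscTwo => 2 * Real.sqrt (1 - ‖z.1‖ ^ 2) * z.1.re
      fun_prop
    · change Continuous fun z : DiscTwo => 2 * Real.sqrt (1 - ‖z.1‖ ^ 2) * z.1.im
      fun_prop
    · change Continuous fun z : DiscTwo => 2 * ‖z.1‖ ^ 2 - 1
      fun_prop

/-- The pinch map `π : P²(p) → P²(p)/S¹ ≅ S²` onto the top cell. -/
noncomputable def pinchMap (p : ℕ) : C(MooreSpace p, SphereTwo) where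
  toFun := Quotient.lift discToSphereTwo (by
    rintro z w (rfl | ⟨hz, hw, -⟩)
    · rfl
    · simp [discToSphereTwo, hz, hw])
  continuous_toFun := Continuous.quotient_lift discToSphereTwo.continuous _

/-!
The pullback of a bundle on `P²(p)` to the disc has a frame, and so has its restriction to the
`1`-skeleton. The determinant of the transition matrix between the two frames over the boundary of
the disc is a map `S¹ → ℂ*`; its winding number changes by a multiple of `p` when the frame on the
skeleton is changed, and gives an invariant in `ℤ/p`, additive under sums and tensor products.

The invariant is complete. In rank at least `2` a bundle over a complex of dimension at most `3` has
a section without zeros, because a smooth map into a space of larger dimension misses arbitrarily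
small vectors; so everything is reduced to line bundles, and line bundles with the same invariant
are isomorphic, because a map `S¹ → ℂ*` of degree `0` extends over the disc. The lens space is
`P²(p)` with a `3`-cell attached, and isomorphisms of line bundles extend over this cell because
maps `S² → ℂ*` have logarithms. The sphere is `P²(0)`.

The pinch map extends over the `3`-cell, seen as the cylinder `D² × [0, 1]` whose top is glued to
its bottom with a rotation: undo the rotation gradually along the cylinder.
-/

open ContinuousMap (Homotopic)
open scoped unitInterval Matrix

/-! ### Images of projections under operators -/

section StarRing

variable {R : Type*} [Ring R] [StarRing R] {a p : R}

/-- The Gram element `(ap)⋆(ap) + (1 - p)`: for a projection `p` of a Hilbert space it is the Gram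
operator of `a` on the range of `p`, extended by the identity so that it can be inverted in the
whole ring. -/
def gramElement (a p : R) : R := star (a * p) * (a * p) + (1 - p)

/-- The orthogonal projection onto the image under `a` of the range of the projection `p`. It is a
rational function of `a` and `p`, hence depends continuously on them. -/
noncomputable def imageProjection (a p : R) : R :=
  a * p * Ring.inverse (gramElement a p) * star (a * p)

theorem gramElement_mul (hp : IsStarProjection p) :
    gramElement a p * p = star (a * p) * (a * p) := by
  rw [gramElement, add_mul, sub_mul, one_mul, hp.isIdempotentElem.eq, sub_self, add_zero,
    mul_assoc, mul_assoc a, hp.isIdempotentElem.eq]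

theorem isSelfAdjoint_gramElement (hp : IsStarProjection p) : IsSelfAdjoint (gramElement a p) :=
  (IsSelfAdjoint.star_mul_self _).add (hp.one_sub).isSelfAdjoint

theorem commute_gramElement (hp : IsStarProjection p) : Commute p (gramElement a p) := by
  have h := congrArg star (gramElement_mul (a := a) hp)
  rw [star_mul, (isSelfAdjoint_gramElement hp).star_eq, hp.isSelfAdjoint.star_eq,
    (IsSelfAdjoint.star_mul_self _).star_eq] at h
  exact h.trans (gramElement_mul hp).symm

theorem imageProjection_mul (hp : IsStarProjection p) (hu : IsUnit (gramElement a p)) :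
    imageProjection a p * (a * p) = a * p := by
  rw [imageProjection, mul_assoc _ (star _), ← gramElement_mul hp, ← mul_assoc,
    mul_assoc _ (Ring.inverse _), Ring.inverse_mul_cancel _ hu, mul_one, mul_assoc,
    hp.isIdempotentElem.eq]

theorem isStarProjection_imageProjection (hp : IsStarProjection p)
    (hu : IsUnit (gramElement a p)) : IsStarProjection (imageProjection a p) where
  isIdempotentElem := by
    change imageProjection a p * imageProjection a p = imageProjection a p
    nth_rw 2 [imageProjection]
    rw [← mul_assoc, ← mul_assoc, imageProjection_mul hp hu, imageProjection]
  isSelfAdjoint := by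
    have hi : star (Ring.inverse (gramElement a p)) = Ring.inverse (gramElement a p) := by
      rw [← Ring.inverse_star, (isSelfAdjoint_gramElement hp).star_eq]
    rw [IsSelfAdjoint, imageProjection, star_mul, star_star, star_mul (a * p), hi, ← mul_assoc]

end StarRing

theorem continuousAt_imageProjection {R Y : Type*} [NormedRing R] [HasSummableGeomSeries R]
    [StarRing R] [ContinuousStar R] [TopologicalSpace Y] {a p : Y → R} {y : Y}
    (ha : ContinuousAt a y) (hp : ContinuousAt p y) (hu : IsUnit (gramElement (a y) (p y))) :
    ContinuousAt (fun y => imageProjection (a y) (p y)) y := by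
  have hap : ContinuousAt (fun y => a y * p y) y := ha.mul hp
  have hgram : ContinuousAt (fun y => gramElement (a y) (p y)) y :=
    (hap.star.mul hap).add (continuousAt_const.sub hp)
  obtain ⟨x, hx⟩ := hu
  have hinv : ContinuousAt (fun y => Ring.inverse (gramElement (a y) (p y))) y :=
    ContinuousAt.comp (g := Ring.inverse) (hx ▸ NormedRing.inverse_continuousAt x) hgram
  exact (hap.mul hinv).mul hap.star

section Hilbert

variable {𝕜 H : Type*} [RCLike 𝕜] [NormedAddCommGroup H] [InnerProductSpace 𝕜 H] [CompleteSpace H]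
  {A P : H →L[𝕜] H}

theorem mem_range_iff_of_isStarProjection (hP : IsStarProjection P) {u : H} :
    u ∈ P.range ↔ P u = u :=
  LinearMap.IsIdempotentElem.mem_range_iff
    (ContinuousLinearMap.isIdempotentElem_toLinearMap_iff.2 hP.isIdempotentElem)

theorem gramElement_apply_eq_zero (hP : IsStarProjection P) (hA : ∀ u ∈ P.range, A u = 0 → u = 0)
    {u : H} (hu : gramElement A P u = 0) : u = 0 := by
  have hcomm : gramElement A P (P u) = 0 := by
    rw [← mul_apply_eq_comp, ← (commute_gramElement hP).eq, mul_apply_eq_comp, hu, map_zero]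
  have hadj : (A * P).adjoint ((A * P) u) = 0 := by
    rw [← ContinuousLinearMap.star_eq_adjoint, ← mul_apply_eq_comp, ← gramElement_mul hP,
      mul_apply_eq_comp, hcomm]
  have hAP : (A * P) u = 0 := by
    rw [← inner_self_eq_zero (𝕜 := 𝕜), ← ContinuousLinearMap.adjoint_inner_right, hadj,
      inner_zero_right]
  have hPu : P u = 0 := hA _ ⟨u, rfl⟩ hAP
  have h1 : gramElement A P u = (A * P).adjoint ((A * P) u) + (u - P u) := rfl
  rw [← hu, h1, hadj, hPu, zero_add, sub_zero]

theorem isUnit_gramElement [FiniteDimensional 𝕜 P.range] (hP : IsStarProjection P)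
    (hA : ∀ u ∈ P.range, A u = 0 → u = 0) : IsUnit (gramElement A P) := by
  rw [ContinuousLinearMap.isUnit_iff_bijective]
  refine ⟨(injective_iff_map_eq_zero _).2 fun u => gramElement_apply_eq_zero hP hA, fun y => ?_⟩
  have hcomm (u : H) : P (gramElement A P u) = gramElement A P (P u) :=
    congrArg (fun T => T u) (commute_gramElement hP).eq
  have hcompl (u : H) : gramElement A P (u - P u) = u - P u := by
    have hPP : P (P u) = P u := (mem_range_iff_of_isStarProjection hP).1 ⟨u, rfl⟩
    simp [gramElement, hPP]
  let S : P.range →ₗ[𝕜] P.range := (gramElement A P).toLinearMap.restrict (by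
    rintro _ ⟨u, rfl⟩
    exact ⟨_, hcomm u⟩)
  have hS : Function.Surjective S := by
    rw [← LinearMap.injective_iff_surjective, injective_iff_map_eq_zero]
    exact fun u hu => Subtype.ext (gramElement_apply_eq_zero hP hA (congrArg Subtype.val hu))
  obtain ⟨u, hu⟩ := hS ⟨P y, y, rfl⟩
  refine ⟨u + (y - P y), ?_⟩
  rw [map_add, hcompl, show gramElement A P u = P y from congrArg Subtype.val hu, add_sub_cancel]

theorem range_imageProjection [FiniteDimensional 𝕜 P.range] (hP : IsStarProjection P)
    (hA : ∀ u ∈ P.range, A u = 0 → u = 0) :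
    (imageProjection A P).range = P.range.map A.toLinearMap := by
  ext v
  constructor
  · rintro ⟨u, rfl⟩
    exact ⟨P _, ⟨_, rfl⟩, rfl⟩
  · rintro ⟨u, hu, rfl⟩
    refine ⟨A u, ?_⟩
    have := congrArg (fun T => T u) (imageProjection_mul hP (isUnit_gramElement hP hA))
    simpa [(mem_range_iff_of_isStarProjection hP).1 hu] using this

end Hilbert

theorem rank_map_of_forall_eq_zero {R M : Type*} [Ring R] [AddCommGroup M] [Module R M]
    {A : M →ₗ[R] M} {S : Submodule R M} (hA : ∀ u ∈ S, A u = 0 → u = 0) :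
    Module.rank R (S.map A) = Module.rank R S := by
  rw [← LinearMap.range_domRestrict]
  exact (LinearEquiv.ofInjective _ ((injective_iff_map_eq_zero _).2
    fun u hu => Subtype.ext (hA u u.2 hu))).rank_eq.symm

namespace BU

variable {n : ℕ}

theorem mem_range_iff (P : BU n) {u : EllTwo} : u ∈ P.1.range ↔ P.1 u = u :=
  mem_range_iff_of_isStarProjection P.2.1

theorem apply_mem (P : BU n) (u : EllTwo) : P.1 u ∈ P.1.range := ⟨u, rfl⟩

theorem ext_range {P Q : BU n} (h : P.1.range = Q.1.range) : P = Q :=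
  Subtype.ext (ContinuousLinearMap.IsStarProjection.ext P.2.1 Q.2.1 h)

instance finiteDimensional_range (P : BU n) : FiniteDimensional ℂ P.1.range :=
  Module.finite_of_rank_eq_nat P.2.2

theorem finrank_range (P : BU n) : Module.finrank ℂ P.1.range = n :=
  Module.finrank_eq_of_rank_eq P.2.2

/-- The image under `A` of a point of `BU(n)`, `A` being injective on the corresponding
subspace. -/
noncomputable def image (P : BU n) (A : EllTwo →L[ℂ] EllTwo)
    (hA : ∀ u ∈ P.1.range, A u = 0 → u = 0) : BU n :=
  ⟨imageProjection A P.1, isStarProjection_imageProjection P.2.1 (isUnit_gramElement P.2.1 hA), by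
    rw [range_imageProjection P.2.1 hA, rank_map_of_forall_eq_zero hA, P.2.2]⟩

theorem range_image (P : BU n) {A : EllTwo →L[ℂ] EllTwo}
    (hA : ∀ u ∈ P.1.range, A u = 0 → u = 0) :
    (P.image A hA).1.range = P.1.range.map A.toLinearMap :=
  range_imageProjection P.2.1 hA

theorem continuousAt_of_range_eq_map {Y : Type*} [TopologicalSpace Y] {P Q : Y → BU n}
    {A : Y → EllTwo →L[ℂ] EllTwo} {y₀ : Y} (hP : ContinuousAt P y₀) (hA : ContinuousAt A y₀)
    (h : ∀ᶠ y in nhds y₀, (∀ u ∈ (P y).1.range, A y u = 0 → u = 0) ∧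
      (Q y).1.range = (P y).1.range.map (A y).toLinearMap) : ContinuousAt Q y₀ := by
  refine Topology.IsInducing.subtypeVal.continuousAt_iff.2 ?_
  refine (continuousAt_imageProjection hA (p := fun y => (P y).1)
    (continuous_subtype_val.continuousAt.comp hP)
    (isUnit_gramElement (P y₀).2.1 h.self_of_nhds.1)).congr ?_
  filter_upwards [h] with y hy
  exact congrArg Subtype.val (ext_range (((P y).range_image hy.1).trans hy.2.symm))

theorem map_range_eq {P Q : BU n} {T : EllTwo →L[ℂ] EllTwo}
    (h : ∀ u ∈ P.1.range, T u ∈ Q.1.range ∧ (T u = 0 → u = 0)) :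
    P.1.range.map T.toLinearMap = Q.1.range := by
  refine Submodule.eq_of_le_of_finrank_eq ?_ ?_
  · rintro _ ⟨u, hu, rfl⟩
    exact (h u hu).1
  · rw [Q.finrank_range]
    exact Module.finrank_eq_of_rank_eq
      ((rank_map_of_forall_eq_zero fun u hu => (h u hu).2).trans P.2.2)

end BU

/-! ### Bundle isomorphisms and homotopies -/

/-- The bundles classified by `f` and `g` are isomorphic. The isomorphism is given by a continuous
family of operators on the whole space `ℓ²(ℕ)`, whose values off the fibres of `f` are
irrelevant. -/
def BundleIso {X : Type*} [TopologicalSpace X] {n : ℕ} (f g : C(X, BU n)) : Prop :=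
  ∃ T : C(X, EllTwo →L[ℂ] EllTwo), ∀ x, ∀ u ∈ (f x).1.range,
    T x u ∈ (g x).1.range ∧ (T x u = 0 → u = 0)

section BundleIso

variable {X Y : Type*} [TopologicalSpace X] [TopologicalSpace Y] {n : ℕ}

theorem BundleIso.refl (f : C(X, BU n)) : BundleIso f f :=
  ⟨.const X 1, fun _ _ hu => ⟨hu, id⟩⟩

theorem BundleIso.trans {f g h : C(X, BU n)} : BundleIso f g → BundleIso g h → BundleIso f h := by
  rintro ⟨T, hT⟩ ⟨S, hS⟩
  refine ⟨S * T, fun x u hu => ⟨(hS x _ (hT x u hu).1).1, fun h => ?_⟩⟩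
  exact (hT x u hu).2 ((hS x _ (hT x u hu).1).2 h)

theorem BundleIso.comp {f g : C(X, BU n)} (h : BundleIso f g) (q : C(Y, X)) :
    BundleIso (f.comp q) (g.comp q) := by
  obtain ⟨T, hT⟩ := h
  exact ⟨T.comp q, fun y => hT (q y)⟩

theorem homotopic_of_range_eq_map {f g₀ g₁ : C(X, BU n)} (A : C(I × X, EllTwo →L[ℂ] EllTwo))
    (hA : ∀ t x, ∀ u ∈ (f x).1.range, A (t, x) u = 0 → u = 0)
    (h₀ : ∀ x, (g₀ x).1.range = (f x).1.range.map (A (0, x)).toLinearMap)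
    (h₁ : ∀ x, (g₁ x).1.range = (f x).1.range.map (A (1, x)).toLinearMap) :
    Homotopic g₀ g₁ := by
  refine ⟨⟨⟨fun y => (f y.2).image (A y) (hA y.1 y.2), ?_⟩, fun x => ?_, fun x => ?_⟩⟩
  · refine continuous_iff_continuousAt.2 fun y => ?_
    refine BU.continuousAt_of_range_eq_map (P := fun y => f y.2) (A := A) (by fun_prop)
      (by fun_prop) (Filter.Eventually.of_forall fun y => ⟨hA y.1 y.2, ?_⟩)
    exact BU.range_image _ (hA y.1 y.2)
  · exact BU.ext_range ((BU.range_image _ (hA 0 x)).trans (h₀ x).symm)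
  · exact BU.ext_range ((BU.range_image _ (hA 1 x)).trans (h₁ x).symm)

/-- The image of a bundle under a fixed injective operator. -/
noncomputable def bundleImage (f : C(X, BU n)) (A : EllTwo →L[ℂ] EllTwo)
    (hA : Function.Injective A) : C(X, BU n) where
  toFun x := (f x).image A fun _ _ => (map_eq_zero_iff A hA).1
  continuous_toFun := continuous_iff_continuousAt.2 fun _ =>
    BU.continuousAt_of_range_eq_map (P := f) (A := fun _ => A) (by fun_prop) (by fun_prop)
      (Filter.Eventually.of_forall fun _ =>
        ⟨fun _ _ => (map_eq_zero_iff A hA).1, BU.range_image _ _⟩)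

theorem range_bundleImage (f : C(X, BU n)) {A : EllTwo →L[ℂ] EllTwo}
    (hA : Function.Injective A) (x : X) :
    (bundleImage f A hA x).1.range = (f x).1.range.map A.toLinearMap :=
  BU.range_image _ fun _ _ => (map_eq_zero_iff A hA).1

theorem eq_zero_of_convexComb_isometry_eq_zero {E : Type*} [NormedAddCommGroup E] [NormedSpace ℝ E]
    (V : E →ₗᵢ[ℝ] E) (hV : ∀ u, V u = -u → u = 0) {t : ℝ} (ht : t ∈ I) {u : E}
    (h : (1 - t) • u + t • V u = 0) : u = 0 := by
  have hVu : t • V u = -((1 - t) • u) := eq_neg_of_add_eq_zero_right h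
  by_contra hu
  have hnorm := congrArg norm hVu
  rw [norm_neg, norm_smul, norm_smul, V.norm_map, Real.norm_of_nonneg ht.1,
    Real.norm_of_nonneg (sub_nonneg.2 ht.2)] at hnorm
  have ht' : 1 - t = t := (mul_right_cancel₀ (norm_ne_zero_iff.2 hu) hnorm).symm
  have ht0 : t ≠ 0 := by linarith
  rw [ht', ← smul_neg] at hVu
  exact hu (hV u (smul_right_injective _ ht0 hVu))

theorem homotopic_bundleImage (f : C(X, BU n)) (V : EllTwo →ₗᵢ[ℂ] EllTwo)
    (hV : ∀ u, V u = -u → u = 0) :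
    Homotopic f (bundleImage f V.toContinuousLinearMap V.injective) := by
  let A : C(I × X, EllTwo →L[ℂ] EllTwo) :=
    ⟨fun y => (1 - y.1 : ℝ) • (1 : EllTwo →L[ℂ] EllTwo) + (y.1 : ℝ) • V.toContinuousLinearMap,
      by fun_prop⟩
  have hA (t : I) (x : X) (u : EllTwo) : A (t, x) u = (1 - t : ℝ) • u + (t : ℝ) • V u := rfl
  refine homotopic_of_range_eq_map (f := f) A (fun t x u _ h => ?_) (fun x => ?_) fun x => ?_
  · let Vℝ : EllTwo →ₗᵢ[ℝ] EllTwo := ⟨V.toLinearMap.restrictScalars ℝ, V.norm_map⟩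
    exact eq_zero_of_convexComb_isometry_eq_zero Vℝ hV t.2 ((hA t x u).symm.trans h)
  · have : A (0, x) = 1 := by ext1 u; simp [hA]
    rw [this]
    exact (Submodule.map_id _).symm
  · have : A (1, x) = V.toContinuousLinearMap := by ext1 u; simp [hA]
    rw [this]
    exact range_bundleImage _ _ _

end BundleIso

theorem ellBasis_repr (u : EllTwo) (i : ℕ) : inner ℂ (ellBasis i) u = u i := by
  rw [← HilbertBasis.repr_apply_apply]
  rfl

theorem ellEmb_basis (φ : ℕ → ℕ) (hφ : Function.Injective φ) (i : ℕ) :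
    ellEmb φ hφ (ellBasis i) = ellBasis (φ i) := by
  have h : (ellBasis i : EllTwo) = lp.single 2 i (1 : ℂ) :=
    (ellBasis.repr_symm_single i).symm
  rw [h, ellEmb, OrthogonalFamily.linearIsometry_apply_single]
  simp

theorem ellEmb_apply_apply (φ : ℕ → ℕ) (hφ : Function.Injective φ) (u : EllTwo) (i : ℕ) :
    ellEmb φ hφ u (φ i) = u i := by
  rw [← ellBasis_repr, ← ellEmb_basis φ hφ, LinearIsometry.inner_map_map, ellBasis_repr]

theorem ellEmb_apply_of_forall_ne (φ : ℕ → ℕ) (hφ : Function.Injective φ) (u : EllTwo) (j : ℕ)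
    (hj : ∀ i, φ i ≠ j) : ellEmb φ hφ u j = 0 := by
  have hsum := ((ellBasis.orthonormal.comp φ hφ).orthogonalFamily.hasSum_linearIsometry u).mapL
    (innerSL ℂ (ellBasis j))
  rw [← ellBasis_repr]
  refine hsum.unique ?_
  convert hasSum_zero with i
  simp [ellBasis.orthonormal.2 (hj i).symm]

/-- A shift `e i ↦ e (φ i)` with `i ≤ φ i` has no eigenvector for the eigenvalue `-1`: the first
nonzero coordinate of one would be fixed or killed by the shift. -/
theorem eq_zero_of_ellEmb_eq_neg (φ : ℕ → ℕ) (hφ : Function.Injective φ) (hle : ∀ i, i ≤ φ i)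
    {u : EllTwo} (h : ellEmb φ hφ u = -u) : u = 0 := by
  have hcoord (j : ℕ) : ellEmb φ hφ u j = -u j := congrArg (fun v : EllTwo => v j) h
  ext j
  induction j using Nat.strong_induction_on with
  | _ j ih =>
    by_cases hj : ∃ i, φ i = j
    · obtain ⟨i, rfl⟩ := hj
      have hi : u i = -u (φ i) := (ellEmb_apply_apply φ hφ u i).symm.trans (hcoord (φ i))
      rcases (hle i).eq_or_lt with heq | hlt
      · rw [← heq] at hi ⊢
        exact self_eq_neg.1 hi
      · simpa [ih i hlt] using hi.symm
    · have hj' := ellEmb_apply_of_forall_ne φ hφ u j fun i hi => hj ⟨i, hi⟩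
      simpa [hj'] using (hcoord j).symm

section BundleIso

variable {X : Type*} [TopologicalSpace X] {n : ℕ}

/-- Isomorphic bundles `f` and `g` are first moved into the orthogonal subspaces of even and odd
coordinates, where the line segment from `f` to `g` stays injective. -/
theorem BundleIso.homotopic {f g : C(X, BU n)} (h : BundleIso f g) : Homotopic f g := by
  obtain ⟨T, hT⟩ := h
  have heven : ∀ u, evenEmb u = -u → u = 0 :=
    fun _ => eq_zero_of_ellEmb_eq_neg _ _ fun i => by omega
  have hodd : ∀ u, oddEmb u = -u → u = 0 :=
    fun _ => eq_zero_of_ellEmb_eq_neg _ _ fun i => by omega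
  refine (homotopic_bundleImage f evenEmb heven).trans
    (Homotopic.trans ?_ (homotopic_bundleImage g oddEmb hodd).symm)
  let A : C(I × X, EllTwo →L[ℂ] EllTwo) :=
    ⟨fun y => (1 - (y.1 : ℝ) : ℂ) • evenEmb.toContinuousLinearMap +
      ((y.1 : ℝ) : ℂ) • (oddEmb.toContinuousLinearMap ∘L T y.2), by fun_prop⟩
  have hA (t : I) (x : X) (u : EllTwo) : A (t, x) u =
      (1 - (t : ℝ) : ℂ) • evenEmb u + ((t : ℝ) : ℂ) • oddEmb (T x u) := rfl
  refine homotopic_of_range_eq_map (f := f) A (fun t x u hu h => ?_) (fun x => ?_) fun x => ?_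
  · rw [hA] at h
    have h1 := congrArg evenEmb.toContinuousLinearMap.adjoint h
    have h2 := congrArg oddEmb.toContinuousLinearMap.adjoint h
    simp only [map_add, map_smul, evenEmb_adjoint_even, evenEmb_adjoint_odd, oddEmb_adjoint_even,
      oddEmb_adjoint_odd, smul_zero, add_zero, zero_add, map_zero] at h1 h2
    rcases smul_eq_zero.1 h2 with h3 | h3
    · simpa [h3] using h1
    · exact (hT x u hu).2 h3
  · have : A (0, x) = evenEmb.toContinuousLinearMap := by ext1 u; simp [hA]
    rw [this]
    exact range_bundleImage _ _ _
  · have : A (1, x) = oddEmb.toContinuousLinearMap ∘L T x := by ext1 u; simp [hA]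
    rw [this]
    refine (range_bundleImage _ _ _).trans ?_
    rw [← BU.map_range_eq (hT x)]
    exact (Submodule.map_comp _ _ _).symm

theorem bundleIso_of_norm_sub_lt {f g : C(X, BU n)} (h : ∀ x, ‖(f x).1 - (g x).1‖ < 1) :
    BundleIso f g := by
  refine ⟨⟨fun x => (g x).1, by fun_prop⟩, fun x u hu => ⟨(g x).apply_mem u, fun h0 => ?_⟩⟩
  by_contra hu0
  have hfix : ((f x).1 - (g x).1) u = u := by
    rw [sub_apply, show (g x).1 u = 0 from h0, (f x).mem_range_iff.1 hu,
      sub_zero]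
  have hle := ((f x).1 - (g x).1).le_opNorm u
  rw [hfix] at hle
  nlinarith [h x, norm_pos_iff.2 hu0]

theorem bundleIso_of_homotopic [CompactSpace X] {f g : C(X, BU n)} (h : Homotopic f g) :
    BundleIso f g := by
  obtain ⟨F⟩ := h
  let Φ : C(I, C(X, EllTwo →L[ℂ] EllTwo)) :=
    ContinuousMap.curry ⟨fun y => (F y).1, by fun_prop⟩
  have hF : ∀ s t : I, BundleIso (F.curry s) (F.curry t) := by
    refine PreconnectedSpace.induction₂' (fun s t => BundleIso (F.curry s) (F.curry t))
      (fun s => ?_) ⟨fun _ _ _ => BundleIso.trans⟩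
    have hnear : ∀ᶠ t in nhds s, dist (Φ t) (Φ s) < 1 :=
      Metric.tendsto_nhds.1 (Φ.continuous.tendsto s) 1 one_pos
    filter_upwards [hnear] with t ht
    have hlt (x : X) : ‖(F (t, x)).1 - (F (s, x)).1‖ < 1 := by
      rw [← dist_eq_norm]
      exact (ContinuousMap.dist_apply_le_dist (f := Φ t) (g := Φ s) x).trans_lt ht
    exact ⟨bundleIso_of_norm_sub_lt fun x => by rw [norm_sub_rev]; exact hlt x,
      bundleIso_of_norm_sub_lt hlt⟩
  have h0 : F.curry 0 = f := by ext1 x; exact F.apply_zero x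
  have h1 : F.curry 1 = g := by ext1 x; exact F.apply_one x
  simpa only [h0, h1] using hF 0 1

end BundleIso

/-! ### Frames -/

/-- `F` is a basis of the subspace `P`. -/
def IsFrame {n : ℕ} (P : BU n) (F : Fin n → EllTwo) : Prop :=
  (∀ j, F j ∈ P.1.range) ∧ LinearIndependent ℂ F

theorem IsFrame.span_eq {n : ℕ} {P : BU n} {F : Fin n → EllTwo} (hF : IsFrame P F) :
    Submodule.span ℂ (Set.range F) = P.1.range := by
  refine Submodule.eq_of_le_of_finrank_eq ?_ ?_
  · rw [Submodule.span_le]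
    rintro _ ⟨j, rfl⟩
    exact hF.1 j
  · rw [finrank_span_eq_card hF.2, P.finrank_range, Fintype.card_fin]

theorem exists_isFrame {n : ℕ} (P : BU n) : ∃ F : Fin n → EllTwo, IsFrame P F := by
  let b := Module.finBasisOfFinrankEq ℂ P.1.range P.finrank_range
  exact ⟨fun j => b j, fun j => (b j).2,
    b.linearIndependent.map' P.1.range.subtype (Submodule.ker_subtype _)⟩

theorem IsFrame.map {n : ℕ} {P Q : BU n} {F : Fin n → EllTwo} (hF : IsFrame P F)
    {T : EllTwo →L[ℂ] EllTwo} (h : ∀ u ∈ P.1.range, T u ∈ Q.1.range ∧ (T u = 0 → u = 0)) :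
    IsFrame Q fun j => T (F j) :=
  ⟨fun j => (h _ (hF.1 j)).1, hF.2.map (f := T.toLinearMap)
    (LinearMap.disjoint_ker.2 fun u hu => (h u (hF.span_eq ▸ hu)).2)⟩

theorem exists_frame {K : Type*} [TopologicalSpace K] [CompactSpace K] [ContractibleSpace K]
    {n : ℕ} (f : C(K, BU n)) : ∃ F : C(K, Fin n → EllTwo), ∀ x, IsFrame (f x) (F x) := by
  obtain ⟨y, hy⟩ := id_nullhomotopic K
  have h : Homotopic (ContinuousMap.const K (f y)) f :=
    (Homotopic.comp (Homotopic.refl f) hy).symm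
  obtain ⟨T, hT⟩ := bundleIso_of_homotopic h
  obtain ⟨F, hF⟩ := exists_isFrame (f y)
  exact ⟨⟨fun x j => T x (F j), by fun_prop⟩, fun x => hF.map (hT x)⟩

section CrossGram

variable {𝕜 E ι κ : Type*} [RCLike 𝕜] [NormedAddCommGroup E] [InnerProductSpace 𝕜 E]

/-- The matrix of inner products of two families of vectors. For frames `F` and `F'` of the same
bundle, `det (crossGram 𝕜 F F')` plays the role of the determinant of the transition function from
`F'` to `F`, from which it differs by a positive factor. -/
noncomputable def crossGram (𝕜 : Type*) [RCLike 𝕜] [InnerProductSpace 𝕜 E] (F : ι → E) (G : κ → E) :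
    Matrix ι κ 𝕜 :=
  Matrix.of fun i j => inner 𝕜 (F i) (G j)

theorem continuous_det_crossGram [Fintype ι] [DecidableEq ι] {Y : Type*} [TopologicalSpace Y]
    {F G : Y → ι → E} (hF : Continuous F) (hG : Continuous G) :
    Continuous fun y => (crossGram 𝕜 (F y) (G y)).det :=
  Continuous.matrix_det <| continuous_matrix fun i j =>
    ((continuous_apply i).comp hF).inner ((continuous_apply j).comp hG)

theorem det_crossGram_ne_zero [Fintype ι] [DecidableEq ι] {F G : ι → E}
    (hG : LinearIndependent 𝕜 G) (hFG : ∀ j, G j ∈ Submodule.span 𝕜 (Set.range F)) :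
    (crossGram 𝕜 F G).det ≠ 0 := by
  intro h
  obtain ⟨c, hc, h0⟩ := Matrix.exists_mulVec_eq_zero_iff.2 h
  refine hc (funext (Fintype.linearIndependent_iff.1 hG c ?_))
  set w := ∑ j, c j • G j with hw
  have horth (i : ι) : inner 𝕜 (F i) w = 0 := by
    simpa [crossGram, Matrix.mulVec, dotProduct, hw, inner_sum, inner_smul_right, mul_comm]
      using congrFun h0 i
  have hspan : Submodule.span 𝕜 (Set.range F) ≤ (𝕜 ∙ w)ᗮ :=
    Submodule.span_le.2 <| Set.range_subset_iff.2 fun i =>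
      Submodule.mem_orthogonal_singleton_iff_inner_left.2 (horth i)
  have hwF : w ∈ Submodule.span 𝕜 (Set.range F) :=
    Submodule.sum_mem _ fun j _ => Submodule.smul_mem _ _ (hFG j)
  exact inner_self_eq_zero.1 (Submodule.mem_orthogonal_singleton_iff_inner_left.1 (hspan hwF))

theorem det_crossGram_of_eq_sum [Fintype ι] [DecidableEq ι] {F G : ι → E} {h : Matrix ι ι 𝕜}
    (hFG : ∀ j, F j = ∑ i, h i j • G i) (Y : ι → E) :
    (crossGram 𝕜 Y F).det = (crossGram 𝕜 Y G).det * h.det := by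
  rw [← Matrix.det_mul]
  congr 1
  ext i j
  simp [crossGram, Matrix.mul_apply, hFG, inner_sum, inner_smul_right, mul_comm]

theorem det_crossGram_append {m n : ℕ} (F F' : Fin m → E) (G G' : Fin n → E)
    (h : ∀ i j, inner 𝕜 (F i) (G' j) = 0) (h' : ∀ i j, inner 𝕜 (G i) (F' j) = 0) :
    (crossGram 𝕜 (Fin.append F G) (Fin.append F' G')).det =
      (crossGram 𝕜 F F').det * (crossGram 𝕜 G G').det := by
  rw [← Matrix.det_fromBlocks_zero₂₁ _ 0, ← Matrix.det_reindex_self finSumFinEquiv]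
  congr 1
  ext i j
  refine Fin.addCases (fun i => ?_) (fun i => ?_) i <;>
    refine Fin.addCases (fun j => ?_) (fun j => ?_) j <;> simp [crossGram, h, h']

end CrossGram

theorem IsFrame.det_crossGram_ne_zero {n : ℕ} {P : BU n} {F G : Fin n → EllTwo}
    (hF : IsFrame P F) (hG : IsFrame P G) : (crossGram ℂ F G).det ≠ 0 :=
  _root_.det_crossGram_ne_zero hG.2 fun j => hF.span_eq ▸ hG.1 j

theorem IsFrame.exists_eq_sum {n : ℕ} {P : BU n} {F G : Fin n → EllTwo} (hF : IsFrame P F)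
    (hG : IsFrame P G) : ∃ h : Matrix (Fin n) (Fin n) ℂ, ∀ j, F j = ∑ i, h i j • G i := by
  have hspan (j : Fin n) : ∃ c : Fin n → ℂ, ∑ i, c i • G i = F j :=
    Submodule.mem_span_range_iff_exists_fun ℂ |>.1 (hG.span_eq ▸ hF.1 j)
  choose c hc using hspan
  exact ⟨Matrix.of fun i j => c j i, fun j => (hc j).symm⟩

/-! ### Whitney sums -/

/-- The Whitney sum of two bundles. -/
noncomputable def bundleSum {X : Type*} [TopologicalSpace X] {m n : ℕ} (f : C(X, BU m))
    (g : C(X, BU n)) : C(X, BU (m + n)) :=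
  (whitneySum m n).comp (f.prodMk g)

/-- The trivial bundle of rank `n`. -/
noncomputable abbrev trivialBundle (X : Type*) [TopologicalSpace X] (n : ℕ) : C(X, BU n) :=
  ContinuousMap.const X (basePointBU n)

theorem mem_range_whitneySum {m n : ℕ} (P : BU m) (Q : BU n) (w : EllTwo) :
    w ∈ (whitneySum m n (P, Q)).1.range ↔
      ∃ u ∈ P.1.range, ∃ v ∈ Q.1.range, w = evenEmb u + oddEmb v := by
  constructor
  · rintro ⟨a, rfl⟩
    exact ⟨_, P.apply_mem _, _, Q.apply_mem _, blockSum_apply P.1 Q.1 a⟩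
  · rintro ⟨u, hu, v, hv, rfl⟩
    refine ⟨evenEmb u + oddEmb v, ?_⟩
    change blockSum P.1 Q.1 _ = _
    rw [blockSum_apply]
    simp only [map_add, evenEmb_adjoint_even, evenEmb_adjoint_odd, oddEmb_adjoint_even,
      oddEmb_adjoint_odd, add_zero, zero_add, P.mem_range_iff.1 hu, Q.mem_range_iff.1 hv]

theorem inner_evenEmb_oddEmb (u v : EllTwo) : inner ℂ (evenEmb u) (oddEmb v) = 0 :=
  ellEmb_inner_zero _ _ _ _ (fun i j => by omega) u v

theorem IsFrame.append {m n : ℕ} {P : BU m} {Q : BU n} {F : Fin m → EllTwo} {G : Fin n → EllTwo}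
    (hF : IsFrame P F) (hG : IsFrame Q G) :
    IsFrame (whitneySum m n (P, Q))
      (Fin.append (fun i => evenEmb (F i)) fun i => oddEmb (G i)) := by
  constructor
  · intro j
    rw [mem_range_whitneySum]
    refine Fin.addCases (fun i => ?_) (fun i => ?_) j
    · exact ⟨F i, hF.1 i, 0, zero_mem _, by simp⟩
    · exact ⟨0, zero_mem _, G i, hG.1 i, by simp⟩
  · rw [Fintype.linearIndependent_iff]
    intro c hc
    simp only [Fin.sum_univ_add, Fin.append_left, Fin.append_right] at hc
    have h1 := congrArg evenEmb.toContinuousLinearMap.adjoint hc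
    have h2 := congrArg oddEmb.toContinuousLinearMap.adjoint hc
    simp only [map_add, map_sum, map_smul, evenEmb_adjoint_even, evenEmb_adjoint_odd,
      oddEmb_adjoint_even, oddEmb_adjoint_odd, smul_zero, Finset.sum_const_zero, add_zero,
      zero_add, map_zero] at h1 h2
    intro j
    refine Fin.addCases (fun i => ?_) (fun i => ?_) j
    · exact Fintype.linearIndependent_iff.1 hF.2 _ h1 i
    · exact Fintype.linearIndependent_iff.1 hG.2 _ h2 i

theorem det_crossGram_even_odd {m n : ℕ} (F F' : Fin m → EllTwo) (G G' : Fin n → EllTwo) :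
    (crossGram ℂ (Fin.append (fun i => evenEmb (F i)) fun i => oddEmb (G i))
      (Fin.append (fun i => evenEmb (F' i)) fun i => oddEmb (G' i))).det =
      (crossGram ℂ F F').det * (crossGram ℂ G G').det := by
  rw [det_crossGram_append _ _ _ _ (fun _ _ => inner_evenEmb_oddEmb _ _)
    fun _ _ => inner_eq_zero_symm.1 (inner_evenEmb_oddEmb _ _)]
  simp only [crossGram, LinearIsometry.inner_map_map]

theorem range_basePointBU_one : (basePointBU 1).1.range = ℂ ∙ ellBasis 0 := by
  have hrange : (Set.range fun i : Fin 1 => ellBasis i) = {ellBasis 0} := by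
    ext
    simp
  rw [basePointBU, Submodule.range_starProjection, hrange]

/-! ### Splitting off a section -/

section RankOne

open InnerProductSpace (rankOne)

variable {𝕜 E F : Type*} [RCLike 𝕜] [NormedAddCommGroup E] [NormedAddCommGroup F]
  [InnerProductSpace 𝕜 F]

theorem continuous_rankOne [NormedSpace 𝕜 E] {Y : Type*} [TopologicalSpace Y] {a : Y → E}
    {b : Y → F} (ha : Continuous a) (hb : Continuous b) :
    Continuous fun y => rankOne 𝕜 (a y) (b y) :=
  ((ContinuousLinearMap.smulRightL 𝕜 F E).continuous.comp
    ((innerSL 𝕜).continuous.comp hb)).clm_apply ha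

variable [CompleteSpace F] {P : F →L[𝕜] F} {v : F}

theorem isStarProjection_sub_rankOne (hP : IsStarProjection P) (hv : ‖v‖ = 1) (h : v ∈ P.range) :
    IsStarProjection (P - rankOne 𝕜 v v) := by
  refine (InnerProductSpace.isStarProjection_rankOne_self hv).sub_of_mul_eq_right hP ?_
  ext1 u
  simp [(mem_range_iff_of_isStarProjection hP).1 h]

theorem range_sub_rankOne (hP : IsStarProjection P) (hv : ‖v‖ = 1) (h : v ∈ P.range) :
    (P - rankOne 𝕜 v v).range = (𝕜 ∙ v)ᗮ ⊓ P.range := by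
  ext u
  have happly : (P - rankOne 𝕜 v v) u = P u - inner 𝕜 v u • v := rfl
  rw [Submodule.mem_inf, Submodule.mem_orthogonal_singleton_iff_inner_right,
    mem_range_iff_of_isStarProjection (isStarProjection_sub_rankOne hP hv h),
    mem_range_iff_of_isStarProjection hP, happly]
  constructor
  · intro h1
    have hvP : inner 𝕜 v (P u) = inner 𝕜 v u := by
      have hsymm : inner 𝕜 (P v) u = inner 𝕜 v (P u) := hP.isSelfAdjoint.isSymmetric v u
      rw [← hsymm, (mem_range_iff_of_isStarProjection hP).1 h]
    have hvu : inner 𝕜 v u = 0 := by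
      have := congrArg (inner 𝕜 v) h1
      rw [inner_sub_right, hvP, inner_smul_right, inner_self_eq_norm_sq_to_K, hv] at this
      simpa using this.symm
    exact ⟨hvu, by rwa [hvu, zero_smul, sub_zero] at h1⟩
  · rintro ⟨h1, h2⟩
    rw [h1, h2, zero_smul, sub_zero]

end RankOne

/-- The complement in `P` of a line spanned by a unit vector. -/
noncomputable def BU.compl {n : ℕ} (P : BU (n + 1)) (v : EllTwo) (hv : ‖v‖ = 1)
    (h : v ∈ P.1.range) : BU n :=
  ⟨P.1 - InnerProductSpace.rankOne ℂ v v, isStarProjection_sub_rankOne P.2.1 hv h, by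
    have hfin := Submodule.finrank_add_inf_finrank_orthogonal
      ((Submodule.span_singleton_le_iff_mem v _).2 h)
    rw [P.finrank_range, finrank_span_singleton (norm_ne_zero_iff.1 (hv ▸ one_ne_zero)),
      add_comm, add_left_inj] at hfin
    have : FiniteDimensional ℂ ((ℂ ∙ v)ᗮ ⊓ P.1.range : Submodule ℂ EllTwo) :=
      Submodule.finiteDimensional_inf_right _ _
    rw [range_sub_rankOne P.2.1 hv h, ← Module.finrank_eq_rank, hfin]⟩

theorem BU.mem_range_compl {n : ℕ} {P : BU (n + 1)} {v : EllTwo} (hv : ‖v‖ = 1)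
    (h : v ∈ P.1.range) {u : EllTwo} :
    u ∈ (P.compl v hv h).1.range ↔ inner ℂ v u = 0 ∧ u ∈ P.1.range := by
  rw [BU.compl, range_sub_rankOne P.2.1 hv h, Submodule.mem_inf,
    Submodule.mem_orthogonal_singleton_iff_inner_right]

section SplitSection

variable {X : Type*} [TopologicalSpace X] {n : ℕ} (f : C(X, BU (n + 1))) (s : C(X, EllTwo))

theorem exists_bundleSum_of_unit_section (hs : ∀ x, s x ∈ (f x).1.range) (hs1 : ∀ x, ‖s x‖ = 1) :
    ∃ g : C(X, BU n), BundleIso (bundleSum g (trivialBundle X 1)) f := by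
  let g : C(X, BU n) := ⟨fun x => (f x).compl (s x) (hs1 x) (hs x),
    ((continuous_subtype_val.comp f.continuous).sub
      (continuous_rankOne s.continuous s.continuous)).subtype_mk _⟩
  let T : C(X, EllTwo →L[ℂ] EllTwo) := ⟨fun x => evenEmb.toContinuousLinearMap.adjoint +
    InnerProductSpace.rankOne ℂ (s x) (ellBasis 0) ∘L oddEmb.toContinuousLinearMap.adjoint,
    continuous_const.add
      ((continuous_rankOne s.continuous continuous_const).clm_comp continuous_const)⟩
  have hT (x : X) (u : EllTwo) (c : ℂ) : T x (evenEmb u + oddEmb (c • ellBasis 0)) =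
      u + c • s x := by
    simp [T, evenEmb_adjoint_even, evenEmb_adjoint_odd, oddEmb_adjoint_even, oddEmb_adjoint_odd,
      ellBasis.orthonormal.1 0]
  refine ⟨g, T, fun x w hw => ?_⟩
  obtain ⟨u, hu, _, hv, rfl⟩ := (mem_range_whitneySum _ _ _).1 hw
  rw [ContinuousMap.const_apply, range_basePointBU_one] at hv
  obtain ⟨c, rfl⟩ := Submodule.mem_span_singleton.1 hv
  obtain ⟨hsu, hu⟩ := (BU.mem_range_compl (hs1 x) (hs x)).1 hu
  rw [hT]
  refine ⟨add_mem hu (Submodule.smul_mem _ _ (hs x)), fun h0 => ?_⟩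
  have hc : c = 0 := by
    have := congrArg (inner ℂ (s x)) h0
    rw [inner_add_right, hsu, inner_smul_right, inner_self_eq_norm_sq_to_K, hs1] at this
    simpa using this
  rw [hc, zero_smul, add_zero] at h0
  simp [h0, hc]

theorem exists_bundleSum_of_section (hs : ∀ x, s x ∈ (f x).1.range) (hs0 : ∀ x, s x ≠ 0) :
    ∃ g : C(X, BU n), BundleIso (bundleSum g (trivialBundle X 1)) f := by
  let v : C(X, EllTwo) := ⟨fun x => ((‖s x‖⁻¹ : ℝ) : ℂ) • s x,
    (Complex.continuous_ofReal.comp (s.continuous.norm.inv₀ fun x =>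
      norm_ne_zero_iff.2 (hs0 x))).smul s.continuous⟩
  refine exists_bundleSum_of_unit_section f v (fun x => Submodule.smul_mem _ _ (hs x)) fun x => ?_
  change ‖((‖s x‖⁻¹ : ℝ) : ℂ) • s x‖ = 1
  rw [norm_smul, Complex.norm_real, norm_inv, norm_norm,
    inv_mul_cancel₀ (norm_ne_zero_iff.2 (hs0 x))]

end SplitSection

/-! ### Degrees of maps from the circle -/

theorem exists_log {K : Type*} [TopologicalSpace K] [ContractibleSpace K] (b : C(K, ℂ))
    (hb : ∀ x, b x ≠ 0) : ∃ l : C(K, ℂ), ∀ x, Complex.exp (l x) = b x := by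
  have hcov := Complex.isAddQuotientCoveringMap_exp.isCoveringMap
  obtain ⟨y, hy⟩ := id_nullhomotopic K
  let b' : C(K, {z : ℂ // z ≠ 0}) := ⟨fun x => ⟨b x, hb x⟩, by fun_prop⟩
  obtain ⟨H⟩ : Homotopic (ContinuousMap.const K (b' y)) b' :=
    (Homotopic.comp (Homotopic.refl b') hy).symm
  have h0 (x : K) : H.toContinuousMap (0, x) = (fun z : ℂ => (⟨Complex.exp z, z.exp_ne_zero⟩ :
      {z : ℂ // z ≠ 0})) (ContinuousMap.const K (Complex.log (b y)) x) :=
    (H.apply_zero x).trans (Subtype.ext (Complex.exp_log (hb y)).symm)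
  refine ⟨(hcov.liftHomotopy H.toContinuousMap _ h0).comp
    ((ContinuousMap.const K 1).prodMk (ContinuousMap.id K)), fun x => ?_⟩
  exact congrArg Subtype.val
    ((congrFun (hcov.liftHomotopy_lifts H.toContinuousMap _ h0) (1, x)).trans (H.apply_one x))

theorem eq_of_exp_eq {Y : Type*} [TopologicalSpace Y] [PreconnectedSpace Y] {a b : Y → ℂ}
    (ha : Continuous a) (hb : Continuous b) (h : ∀ y, Complex.exp (a y) = Complex.exp (b y))
    {y₀ : Y} (h₀ : a y₀ = b y₀) : a = b :=
  Complex.isAddQuotientCoveringMap_exp.isCoveringMap.eq_of_comp_eq ha hb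
    (funext fun y => Subtype.ext (h y)) y₀ h₀

instance : ContractibleSpace I := (convex_Icc (0 : ℝ) 1).contractibleSpace ⟨0, by simp⟩

instance : ContractibleSpace DiscTwo :=
  (convex_closedBall (0 : ℂ) 1).contractibleSpace ⟨0, by simp⟩

/-- The parametrization `t ↦ e^{2πit}` of the circle. -/
noncomputable def circleParam : C(I, Circle) :=
  ⟨fun t => Circle.exp (2 * Real.pi * t), by fun_prop⟩

theorem coe_circleParam (t : I) :
    (circleParam t : ℂ) = Complex.exp (2 * Real.pi * Complex.I * (t : ℝ)) := by
  simp only [circleParam, ContinuousMap.coe_mk, Circle.coe_exp]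
  congr 1
  push_cast
  ring

theorem circleParam_surjective : Function.Surjective circleParam := by
  intro z
  obtain ⟨x, rfl⟩ := Circle.exp_surjective z
  obtain ⟨y, hy, hxy⟩ := Circle.periodic_exp.exists_mem_Ico₀ Real.two_pi_pos x
  refine ⟨⟨y / (2 * Real.pi), div_nonneg hy.1 Real.two_pi_pos.le,
    div_le_one_of_le₀ hy.2.le Real.two_pi_pos.le⟩, ?_⟩
  change Circle.exp (2 * Real.pi * (y / (2 * Real.pi))) = _
  rw [mul_div_cancel₀ _ Real.two_pi_pos.ne', hxy]

theorem isQuotientMap_circleParam : Topology.IsQuotientMap circleParam :=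
  circleParam.continuous.isClosedMap.isQuotientMap circleParam.continuous circleParam_surjective

theorem eq_or_mem_of_circleParam_eq {s t : I} (h : circleParam s = circleParam t) :
    s = t ∨ (s ∈ ({0, 1} : Set I) ∧ t ∈ ({0, 1} : Set I)) := by
  obtain ⟨m, hm⟩ := Circle.exp_eq_exp.1 h
  have hst : (s : ℝ) = t + m :=
    mul_left_cancel₀ Real.two_pi_pos.ne' (by rw [hm]; ring)
  obtain ⟨hs0, hs1⟩ := s.2
  obtain ⟨ht0, ht1⟩ := t.2
  have hm1 : m ≤ 1 := by exact_mod_cast (by linarith : (m : ℝ) ≤ 1)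
  have hm0 : -1 ≤ m := by exact_mod_cast (by linarith : (-1 : ℝ) ≤ m)
  obtain rfl | rfl | rfl : m = -1 ∨ m = 0 ∨ m = 1 := by omega
  all_goals push_cast at hst
  · exact Or.inr ⟨Or.inl (Subtype.ext (by push_cast; linarith)),
      Or.inr (Subtype.ext (by push_cast; linarith))⟩
  · exact Or.inl (Subtype.ext (by simpa using hst))
  · exact Or.inr ⟨Or.inr (Subtype.ext (by push_cast; linarith)),
      Or.inl (Subtype.ext (by push_cast; linarith))⟩

theorem circleParam_zero_eq_one : circleParam 0 = circleParam 1 := by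
  simp [circleParam]

/-- The function `φ` on the circle has no zeros and winds `k` times around the origin. -/
def IsDeg (φ : Circle → ℂ) (k : ℤ) : Prop :=
  ∃ L : C(Circle, ℂ), ∀ z, φ z = (z : ℂ) ^ k * Complex.exp (L z)

theorem exists_isDeg {φ : Circle → ℂ} (hφ : Continuous φ) (h0 : ∀ z, φ z ≠ 0) :
    ∃ k, IsDeg φ k := by
  obtain ⟨l, hl⟩ := exists_log (⟨fun t => φ (circleParam t), by fun_prop⟩ : C(I, ℂ))
    fun t => h0 _
  replace hl (t : I) : Complex.exp (l t) = φ (circleParam t) := hl t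
  obtain ⟨k, hk⟩ := Complex.exp_eq_exp_iff_exists_int.1
    ((hl 1).trans ((congrArg φ circleParam_zero_eq_one.symm).trans (hl 0).symm))
  let l' : C(I, ℂ) := ⟨fun t => l t - 2 * Real.pi * Complex.I * (t : ℝ) * k, by fun_prop⟩
  have h01 : l' 0 = l' 1 := by
    simp only [l', ContinuousMap.coe_mk, hk, Set.Icc.coe_zero, Set.Icc.coe_one,
      Complex.ofReal_zero, Complex.ofReal_one]
    ring
  have hfac : Function.FactorsThrough l' circleParam := by
    intro s t hst
    rcases eq_or_mem_of_circleParam_eq hst with rfl | ⟨rfl | rfl, rfl | rfl⟩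
    exacts [rfl, rfl, h01, h01.symm, rfl]
  refine ⟨k, isQuotientMap_circleParam.lift l' hfac, fun z => ?_⟩
  obtain ⟨t, rfl⟩ := circleParam_surjective z
  have hlift : isQuotientMap_circleParam.lift l' hfac (circleParam t) = l' t :=
    congrArg (fun g : C(I, ℂ) => g t) (isQuotientMap_circleParam.lift_comp l' hfac)
  rw [hlift, ← hl, coe_circleParam, ← Complex.exp_int_mul, ← Complex.exp_add]
  congr 1
  simp only [l', ContinuousMap.coe_mk]
  ring

namespace IsDeg

variable {φ ψ χ : Circle → ℂ} {k l : ℤ}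

theorem unique (hk : IsDeg φ k) (hl : IsDeg φ l) : k = l := by
  have hexp {k : ℤ} {L : C(Circle, ℂ)} (hL : ∀ z, φ z = (z : ℂ) ^ k * Complex.exp (L z)) (t : I) :
      Complex.exp (2 * Real.pi * Complex.I * (t : ℝ) * k +
        (L (circleParam t) - L (circleParam 0))) = φ (circleParam t) / φ (circleParam 0) := by
    have h0 : (circleParam 0 : ℂ) = 1 := by simp [coe_circleParam]
    rw [hL, hL (circleParam 0), h0, one_zpow, one_mul, coe_circleParam, ← Complex.exp_int_mul,
      Complex.exp_add, Complex.exp_sub, mul_comm (k : ℂ), mul_div_assoc]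
  obtain ⟨K, hK⟩ := hk
  obtain ⟨L, hL⟩ := hl
  have hlog := eq_of_exp_eq (by fun_prop) (by fun_prop)
    (fun t => (hexp hK t).trans (hexp hL t).symm) (y₀ := 0) (by simp)
  have h1 := congrFun hlog 1
  rw [circleParam_zero_eq_one] at h1
  simpa using h1

theorem mul (hφ : IsDeg φ k) (hψ : IsDeg ψ l) : IsDeg (fun z => φ z * ψ z) (k + l) := by
  obtain ⟨L, hL⟩ := hφ
  obtain ⟨L', hL'⟩ := hψ
  refine ⟨L + L', fun z => ?_⟩
  change φ z * ψ z = _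
  rw [hL, hL', zpow_add₀ (Circle.coe_ne_zero z), ContinuousMap.add_apply, Complex.exp_add]
  ring

theorem of_mul_eq (hψ : IsDeg ψ k) (hχ : IsDeg χ l) (h : ∀ z, φ z * ψ z = χ z) :
    IsDeg φ (l - k) := by
  obtain ⟨L, hL⟩ := hψ
  obtain ⟨L', hL'⟩ := hχ
  refine ⟨L' - L, fun z => ?_⟩
  have hz := Circle.coe_ne_zero z
  rw [zpow_sub₀ hz, ContinuousMap.sub_apply, Complex.exp_sub, div_mul_div_comm, ← hL, ← hL', ← h,
    mul_div_cancel_right₀]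
  exact hL z ▸ mul_ne_zero (zpow_ne_zero _ hz) (Complex.exp_ne_zero _)

theorem comp_pow (h : IsDeg φ k) (p : ℕ) : IsDeg (fun z => φ (z ^ p)) (p * k) := by
  obtain ⟨L, hL⟩ := h
  refine ⟨L.comp ⟨fun z => z ^ p, by fun_prop⟩, fun z => ?_⟩
  change φ (z ^ p) = _
  rw [hL, zpow_mul, zpow_natCast, Circle.coe_pow]
  rfl

end IsDeg

theorem isDeg_zpow (k : ℤ) : IsDeg (fun z => (z : ℂ) ^ k) k := ⟨0, fun z => by simp⟩

theorem isDeg_zero_of_pos {φ : Circle → ℝ} (hφ : Continuous φ) (h : ∀ z, 0 < φ z) :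
    IsDeg (fun z => (φ z : ℂ)) 0 := by
  refine ⟨⟨fun z => (Real.log (φ z) : ℂ),
    Complex.continuous_ofReal.comp (hφ.log fun z => (h z).ne')⟩, fun z => ?_⟩
  rw [zpow_zero, one_mul, ContinuousMap.coe_mk, ← Complex.ofReal_exp, Real.exp_log (h z)]

/-- The boundary circle of the disc. -/
def circleToDisc : C(Circle, DiscTwo) :=
  ⟨fun z => ⟨z, by simp [Circle.norm_coe]⟩, by fun_prop⟩

theorem isDeg_zero_of_disc {ψ : DiscTwo → ℂ} (hψ : Continuous ψ) (h : ∀ z, ψ z ≠ 0) :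
    IsDeg (fun z => ψ (circleToDisc z)) 0 := by
  obtain ⟨l, hl⟩ := exists_log ⟨ψ, hψ⟩ h
  exact ⟨l.comp circleToDisc, fun z => by simp [hl]⟩

/-! ### Sections without zeros -/

section Extension

variable {E V K : Type*} [NormedAddCommGroup E] [NormedSpace ℝ E] [NormedAddCommGroup V]
  [NormedSpace ℝ V] [TopologicalSpace K]

theorem exists_contDiff_near_real [CompactSpace K] (c : C(K, E)) (hc : Function.Injective c)
    (f : C(K, ℝ)) {ε : ℝ} (hε : 0 < ε) :
    ∃ g : E → ℝ, ContDiff ℝ 1 g ∧ ∀ x, |g (c x) - f x| < ε := by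
  let 𝒜 : Subalgebra ℝ C(K, ℝ) :=
    { carrier := {u | ∃ g : E → ℝ, ContDiff ℝ 1 g ∧ ∀ x, u x = g (c x)}
      mul_mem' := by
        rintro u v ⟨g, hg, hu⟩ ⟨h, hh, hv⟩
        exact ⟨fun e => g e * h e, hg.mul hh, fun x => by simp [hu, hv]⟩
      add_mem' := by
        rintro u v ⟨g, hg, hu⟩ ⟨h, hh, hv⟩
        exact ⟨fun e => g e + h e, hg.add hh, fun x => by simp [hu, hv]⟩
      algebraMap_mem' := fun r => ⟨fun _ => r, contDiff_const, fun x => rfl⟩ }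
  have hsep : 𝒜.SeparatesPoints := by
    intro x y hxy
    obtain ⟨φ, hφ⟩ := SeparatingDual.exists_separating_of_ne (R := ℝ) (hc.ne hxy)
    exact ⟨_, ⟨⟨fun x => φ (c x), by fun_prop⟩, ⟨φ, φ.contDiff, fun _ => rfl⟩, rfl⟩, hφ⟩
  obtain ⟨⟨g, g', hg', hg⟩, h⟩ :=
    ContinuousMap.exists_mem_subalgebra_near_continuous_of_separatesPoints 𝒜 hsep f f.continuous
      ε hε
  exact ⟨g', hg', fun x => hg x ▸ h x⟩

theorem exists_contDiff_near [CompactSpace K] [FiniteDimensional ℝ V] (c : C(K, E))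
    (hc : Function.Injective c) (f : C(K, V)) {ε : ℝ} (hε : 0 < ε) :
    ∃ g : E → V, ContDiff ℝ 1 g ∧ ∀ x, ‖g (c x) - f x‖ < ε := by
  let e := (Module.finBasis ℝ V).equivFunL
  obtain ⟨δ, hδ, he⟩ := Metric.continuousAt_iff.1 (e.symm.continuous.continuousAt (x := 0)) ε hε
  simp only [dist_eq_norm, map_zero, sub_zero] at he
  choose g hg hgf using fun j =>
    exists_contDiff_near_real c hc ⟨fun x => e (f x) j, by fun_prop⟩ hδ
  refine ⟨fun v => e.symm fun j => g j v, e.symm.contDiff.comp (contDiff_pi.2 hg), fun x => ?_⟩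
  rw [← e.symm_apply_apply (f x), ← map_sub]
  exact he ((pi_norm_lt_iff hδ).2 fun j => hgf j x)

theorem exists_near_ne_zero [CompactSpace K] [FiniteDimensional ℝ E] [FiniteDimensional ℝ V]
    (c : C(K, E)) (hc : Function.Injective c)
    (hEV : Module.finrank ℝ E < Module.finrank ℝ V) (f : C(K, V)) {ε : ℝ} (hε : 0 < ε) :
    ∃ h : C(K, V), (∀ x, h x ≠ 0) ∧ ∀ x, ‖f x - h x‖ < ε := by
  obtain ⟨g, hg, hgf⟩ := exists_contDiff_near c hc f (half_pos hε)
  -- The image of the smooth map `g` has measure zero, so it misses arbitrarily small vectors.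
  obtain ⟨y, hy, hy'⟩ := Metric.dense_iff.1 (hg.dense_compl_range_of_finrank_lt_finrank hEV) 0
    (ε / 2) (half_pos hε)
  rw [mem_ball_zero_iff] at hy
  refine ⟨⟨fun x => g (c x) - y, (hg.continuous.comp c.continuous).sub continuous_const⟩,
    fun x hx => hy' ⟨c x, sub_eq_zero.1 hx⟩, fun x => ?_⟩
  calc ‖f x - (g (c x) - y)‖ = ‖-(g (c x) - f x) + y‖ := by congr 1; abel
    _ ≤ ‖g (c x) - f x‖ + ‖y‖ := (norm_add_le _ _).trans_eq (by rw [norm_neg])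
    _ < ε := by linarith [hgf x]

theorem exists_ne_zero_eq_of_le_norm (e h : C(K, V)) {m : ℝ} (hm : 0 < m) (h0 : ∀ x, h x ≠ 0)
    (heh : ∀ x, ‖e x - h x‖ < m / 2) :
    ∃ b : C(K, V), (∀ x, b x ≠ 0) ∧ ∀ x, m ≤ ‖e x‖ → b x = e x := by
  let χ (x : K) : ℝ := max 0 (min 1 (2 * ‖e x‖ / m - 1))
  have hχ : Continuous χ := by fun_prop
  refine ⟨⟨fun x => h x + χ x • (e x - h x), by fun_prop⟩, fun x hx => ?_, fun x hx => ?_⟩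
  · change h x + χ x • (e x - h x) = 0 at hx
    rcases le_or_gt (2 * ‖e x‖ / m - 1) 0 with hle | hlt
    · have hχ0 : χ x = 0 := max_eq_left ((min_le_right _ _).trans hle)
      rw [hχ0, zero_smul, add_zero] at hx
      exact h0 x hx
    · have he : e x = (1 - χ x) • (e x - h x) := by
        rw [sub_smul, one_smul, ← sub_eq_zero, ← hx]
        abel
      have hχ1 : ‖1 - χ x‖ ≤ 1 := by
        rw [Real.norm_of_nonneg (sub_nonneg.2 (max_le zero_le_one (min_le_left _ _)))]
        exact sub_le_self _ (le_max_left _ _)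
      have hsmall : ‖e x‖ ≤ ‖e x - h x‖ := by
        conv_lhs => rw [he, norm_smul]
        exact mul_le_of_le_one_left (norm_nonneg _) hχ1
      rw [sub_pos, one_lt_div hm] at hlt
      linarith [heh x]
  · have hχ1 : χ x = 1 := by
      have : 1 ≤ 2 * ‖e x‖ / m - 1 := by
        rw [le_sub_iff_add_le, le_div_iff₀ hm]
        linarith
      simp only [χ, min_eq_left this, max_eq_right zero_le_one]
    change h x + χ x • (e x - h x) = e x
    rw [hχ1, one_smul, add_sub_cancel]

theorem exists_extension_ne_zero [CompactSpace K] [T2Space K] [FiniteDimensional ℝ E]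
    [FiniteDimensional ℝ V] (c : C(K, E)) (hc : Function.Injective c)
    (hEV : Module.finrank ℝ E < Module.finrank ℝ V) {A : Set K} (hA : IsClosed A)
    (a : C(A, V)) (ha : ∀ x, a x ≠ 0) :
    ∃ b : C(K, V), (∀ x, b x ≠ 0) ∧ ∀ x : A, b x = a x := by
  have : TietzeExtension.{_, _} V := inferInstance
  obtain ⟨e, he⟩ := ContinuousMap.exists_restrict_eq hA a
  replace he (x : A) : e x = a x := congrArg (fun g : C(A, V) => g x) he
  obtain ⟨m, hm, hmA⟩ : ∃ m : ℝ, 0 < m ∧ ∀ x ∈ A, m ≤ ‖e x‖ := by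
    rcases A.eq_empty_or_nonempty with rfl | hne
    · exact ⟨1, one_pos, by simp⟩
    · obtain ⟨x₀, hx₀, hmin⟩ := hA.isCompact.exists_isMinOn hne e.continuous.norm.continuousOn
      exact ⟨‖e x₀‖, norm_pos_iff.2 (he ⟨x₀, hx₀⟩ ▸ ha _), fun x hx => hmin hx⟩
  obtain ⟨h, h0, heh⟩ := exists_near_ne_zero c hc hEV e (half_pos hm)
  obtain ⟨b, hb0, hb⟩ := exists_ne_zero_eq_of_le_norm e h hm h0 heh
  exact ⟨b, hb0, fun x => (hb x (hmA x x.2)).trans (he x)⟩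

theorem exists_continuous_coords {𝕜 ι H Y : Type*} [RCLike 𝕜] [NormedAddCommGroup H]
    [InnerProductSpace 𝕜 H] [Fintype ι] [TopologicalSpace Y] {F : Y → ι → H}
    (hF : Continuous F) (hli : ∀ y, LinearIndependent 𝕜 (F y)) {s : Y → H} (hs : Continuous s)
    (hsF : ∀ y, s y ∈ Submodule.span 𝕜 (Set.range (F y))) :
    ∃ a : C(Y, ι → 𝕜), ∀ y, s y = ∑ j, a y j • F y j := by
  classical
  have hdet (y : Y) : (crossGram 𝕜 (F y) (F y)).det ≠ 0 :=
    det_crossGram_ne_zero (hli y) fun j => Submodule.subset_span ⟨j, rfl⟩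
  have hFj (j : ι) : Continuous fun y => F y j := (continuous_apply j).comp hF
  have hM : Continuous fun y => crossGram 𝕜 (F y) (F y) :=
    continuous_matrix fun i j => (hFj i).inner (hFj j)
  refine ⟨⟨fun y => (crossGram 𝕜 (F y) (F y))⁻¹ *ᵥ fun i => inner 𝕜 (F y i) (s y), ?_⟩,
    fun y => ?_⟩
  · refine Continuous.matrix_mulVec ?_ (continuous_pi fun i => (hFj i).inner hs)
    simp only [Matrix.inv_def, Ring.inverse_eq_inv']
    exact (hM.matrix_det.inv₀ hdet).smul hM.matrix_adjugate
  · obtain ⟨c, hc⟩ := (Submodule.mem_span_range_iff_exists_fun 𝕜).1 (hsF y)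
    have hgram : (fun i => inner 𝕜 (F y i) (s y)) = crossGram 𝕜 (F y) (F y) *ᵥ c := by
      funext i
      simp [← hc, crossGram, Matrix.mulVec, dotProduct, inner_sum, inner_smul_right, mul_comm]
    rw [ContinuousMap.coe_mk, hgram, Matrix.mulVec_mulVec,
      Matrix.nonsing_inv_mul _ (isUnit_iff_ne_zero.2 (hdet y)), Matrix.one_mulVec, hc]

/-- The case of interest is a cell `K` attached along its boundary `A`. -/
theorem exists_section_extension [CompactSpace K] [T2Space K] [ContractibleSpace K]
    [FiniteDimensional ℝ E] {X : Type*} [TopologicalSpace X] (c : C(K, E))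
    (hc : Function.Injective c) {q : C(K, X)} (hq : Topology.IsQuotientMap q) {A : Set K}
    (hA : IsClosed A) (hqA : ∀ k k', q k = q k' → k = k' ∨ (k ∈ A ∧ k' ∈ A)) {n : ℕ}
    (hn : Module.finrank ℝ E < 2 * n) (f : C(X, BU n)) (s : C(A, EllTwo))
    (hs : ∀ k : A, s k ∈ (f (q k)).1.range) (hs0 : ∀ k, s k ≠ 0)
    (hsq : ∀ k k' : A, q k = q k' → s k = s k') :
    ∃ S : C(X, EllTwo), (∀ x, S x ∈ (f x).1.range) ∧ (∀ x, S x ≠ 0) ∧ ∀ k : A, S (q k) = s k := by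
  obtain ⟨F, hF⟩ := exists_frame (f.comp q)
  obtain ⟨a, ha⟩ := exists_continuous_coords (𝕜 := ℂ) (F := fun k : A => F k) (by fun_prop)
    (fun k => (hF k).2) s.continuous fun k => (hF k).span_eq ▸ hs k
  obtain ⟨b, hb0, hba⟩ := exists_extension_ne_zero c hc
    (by simpa [Module.finrank_pi_fintype, mul_comm] using hn) hA a
    fun k hk => hs0 k (by rw [ha, hk]; simp)
  let S : C(K, EllTwo) := ⟨fun k => ∑ j, b k j • F k j, by fun_prop⟩
  have hSs (k : A) : S k = s k := by
    rw [ha, ← hba]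
    rfl
  have hfac : Function.FactorsThrough S q := by
    intro k k' hkk'
    rcases hqA k k' hkk' with rfl | ⟨hk, hk'⟩
    · rfl
    · rw [hSs ⟨k, hk⟩, hSs ⟨k', hk'⟩]
      exact hsq _ _ hkk'
  have hlift (k : K) : hq.lift S hfac (q k) = S k :=
    congrArg (fun g : C(K, EllTwo) => g k) (hq.lift_comp S hfac)
  refine ⟨hq.lift S hfac, hq.surjective.forall.2 fun k => ?_, hq.surjective.forall.2 fun k => ?_,
    fun k => (hlift k).trans (hSs k)⟩
  · rw [hlift]
    change ∑ j, b k j • F k j ∈ _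
    exact Submodule.sum_mem _ fun j _ => Submodule.smul_mem _ _ ((hF k).1 j)
  · rw [hlift]
    exact fun h => hb0 k (funext (Fintype.linearIndependent_iff.1 (hF k).2 _ h))

end Extension

theorem exists_section_circle {n : ℕ} (hn : 1 ≤ n) (f : C(Circle, BU n)) :
    ∃ S : C(Circle, EllTwo), (∀ x, S x ∈ (f x).1.range) ∧ ∀ x, S x ≠ 0 := by
  obtain ⟨F, hF⟩ := exists_isFrame (f (circleParam 0))
  have hA : ∀ t ∈ ({0, 1} : Set I), circleParam t = circleParam 0 := by
    rintro t (rfl | rfl)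
    exacts [rfl, circleParam_zero_eq_one.symm]
  obtain ⟨S, hS, hS0, -⟩ := exists_section_extension (E := ℝ) (K := I) (A := {0, 1})
    ⟨Subtype.val, continuous_subtype_val⟩ Subtype.val_injective isQuotientMap_circleParam
    (Set.toFinite _).isClosed (fun _ _ => eq_or_mem_of_circleParam_eq)
    (by rw [Module.finrank_self]; omega) f (ContinuousMap.const _ (F ⟨0, hn⟩))
    (fun k => hA k k.2 ▸ hF.1 _) (fun _ => hF.2.ne_zero _) fun _ _ _ => rfl
  exact ⟨S, hS, hS0⟩

theorem continuous_append_even_odd {Y : Type*} [TopologicalSpace Y] {m n : ℕ}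
    {F : Y → Fin m → EllTwo} {G : Y → Fin n → EllTwo} (hF : Continuous F) (hG : Continuous G) :
    Continuous fun y => Fin.append (fun i => evenEmb (F y i)) fun i => oddEmb (G y i) :=
  (Fin.continuous_append m n).comp <|
    (continuous_pi fun i => evenEmb.continuous.comp ((continuous_apply i).comp hF)).prodMk
      (continuous_pi fun i => oddEmb.continuous.comp ((continuous_apply i).comp hG))

theorem exists_frame_circle {n : ℕ} (f : C(Circle, BU n)) :
    ∃ G : C(Circle, Fin n → EllTwo), ∀ w, IsFrame (f w) (G w) := by
  induction n with
  | zero =>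
    exact ⟨ContinuousMap.const _ 0, fun w => ⟨fun j => j.elim0, linearIndependent_empty_type⟩⟩
  | succ n ih =>
    obtain ⟨S, hS, hS0⟩ := exists_section_circle (Nat.le_add_left 1 n) f
    obtain ⟨g, T, hT⟩ := exists_bundleSum_of_section f S hS hS0
    obtain ⟨G, hG⟩ := ih g
    obtain ⟨b, hb⟩ := exists_isFrame (basePointBU 1)
    have happend := continuous_append_even_odd G.continuous (continuous_const (y := b))
    exact ⟨⟨fun w j => T w (Fin.append (fun i => evenEmb (G w i)) (fun i => oddEmb (b i)) j),
      continuous_pi fun j => T.continuous.clm_apply ((continuous_apply j).comp happend)⟩,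
      fun w => ((hG w).append hb).map (hT w)⟩

/-! ### Line bundles -/

section LineMap

variable {𝕜 E : Type*} [RCLike 𝕜] [NormedAddCommGroup E] [InnerProductSpace 𝕜 E]

variable (𝕜) in
/-- The operator of rank one taking `v` to `w` and vanishing on the orthogonal complement of `v`.
It is zero for `v = 0`. -/
noncomputable def lineMap (w v : E) : E →L[𝕜] E :=
  (inner 𝕜 v v)⁻¹ • InnerProductSpace.rankOne 𝕜 w v

theorem lineMap_apply (w v u : E) : lineMap 𝕜 w v u = (inner 𝕜 v v)⁻¹ • inner 𝕜 v u • w := rfl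

theorem lineMap_self (w : E) {v : E} (hv : v ≠ 0) : lineMap 𝕜 w v v = w :=
  inv_smul_smul₀ (inner_self_ne_zero.2 hv) w

theorem lineMap_smul_smul (w v : E) {c : 𝕜} (hc : c ≠ 0) :
    lineMap 𝕜 (c • w) (c • v) = lineMap 𝕜 w v := by
  ext1 u
  have hc' : starRingEnd 𝕜 c ≠ 0 := (map_ne_zero _).2 hc
  simp only [lineMap_apply, inner_smul_left, inner_smul_right, smul_smul]
  congr 1
  field_simp

theorem continuousAt_lineMap {Y : Type*} [TopologicalSpace Y] {w v : Y → E} {y : Y}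
    (hw : ContinuousAt w y) (hv : ContinuousAt v y) (h : v y ≠ 0) :
    ContinuousAt (fun y => lineMap 𝕜 (w y) (v y)) y := by
  change ContinuousAt (fun y => (inner 𝕜 (v y) (v y))⁻¹ •
    InnerProductSpace.rankOne 𝕜 (w y) (v y)) y
  have hrank : Continuous fun q : E × E => InnerProductSpace.rankOne 𝕜 q.1 q.2 :=
    continuous_rankOne continuous_fst continuous_snd
  exact ((hv.inner (𝕜 := 𝕜) hv).inv₀ (inner_self_ne_zero.2 h)).smul
    (hrank.continuousAt.comp (f := fun y => (w y, v y)) (hw.prodMk hv))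

theorem continuous_lineMap {Y : Type*} [TopologicalSpace Y] {w v : Y → E} (hw : Continuous w)
    (hv : Continuous v) (h : ∀ y, v y ≠ 0) : Continuous fun y => lineMap 𝕜 (w y) (v y) :=
  continuous_iff_continuousAt.2 fun y =>
    continuousAt_lineMap hw.continuousAt hv.continuousAt (h y)

end LineMap

theorem isFrame_one {P : BU 1} {v : EllTwo} (hv : v ∈ P.1.range) (h0 : v ≠ 0) :
    IsFrame P fun _ => v :=
  ⟨fun _ => hv, LinearIndependent.of_subsingleton 0 h0⟩

theorem BU.exists_eq_smul {P : BU 1} {u v : EllTwo} (hu : u ∈ P.1.range) (hv : v ∈ P.1.range)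
    (h0 : v ≠ 0) : ∃ c : ℂ, u = c • v := by
  rw [← (isFrame_one hv h0).span_eq, Set.range_const, Submodule.mem_span_singleton] at hu
  exact hu.imp fun _ => Eq.symm

theorem BU.eq_of_mem_range {P Q : BU 1} {v : EllTwo} (hP : v ∈ P.1.range) (hQ : v ∈ Q.1.range)
    (h0 : v ≠ 0) : P = Q :=
  BU.ext_range ((isFrame_one hP h0).span_eq.symm.trans (isFrame_one hQ h0).span_eq)

/-- The sections `F` and `F'` trivialize the pullbacks to the cell `K`; the isomorphism taking `F`
to `F'` descends to `X` as soon as it does so on the boundary `A`. -/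
theorem bundleIso_of_sections {K X : Type*} [TopologicalSpace K] [TopologicalSpace X] {q : C(K, X)}
    (hq : Topology.IsQuotientMap q) {A : Set K}
    (hqA : ∀ k k', q k = q k' → k = k' ∨ (k ∈ A ∧ k' ∈ A)) {f f' : C(X, BU 1)}
    {F F' : C(K, EllTwo)} (hF : ∀ k, F k ∈ (f (q k)).1.range) (hF0 : ∀ k, F k ≠ 0)
    (hF' : ∀ k, F' k ∈ (f' (q k)).1.range) (hF0' : ∀ k, F' k ≠ 0)
    {T : A → EllTwo →L[ℂ] EllTwo} (hT : ∀ k : A, T k (F k) = F' k)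
    (hTq : ∀ k k' : A, q k = q k' → T k = T k') : BundleIso f f' := by
  let W : C(K, EllTwo →L[ℂ] EllTwo) :=
    ⟨fun k => lineMap ℂ (F' k) (F k), continuous_lineMap F'.continuous F.continuous hF0⟩
  have hfac : Function.FactorsThrough W q := by
    intro k k' hkk'
    rcases hqA k k' hkk' with rfl | ⟨hk, hk'⟩
    · rfl
    · obtain ⟨c, hc⟩ := BU.exists_eq_smul (hF k) (hkk' ▸ hF k') (hF0 k')
      have hc0 : c ≠ 0 := by
        rintro rfl
        exact hF0 k (by simpa using hc)
      have hF'c : F' k = c • F' k' := by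
        rw [← hT ⟨k, hk⟩, ← hT ⟨k', hk'⟩, hTq ⟨k, hk⟩ ⟨k', hk'⟩ hkk', ← map_smul, ← hc]
      change lineMap ℂ (F' k) (F k) = lineMap ℂ (F' k') (F k')
      rw [hc, hF'c, lineMap_smul_smul _ _ hc0]
  refine ⟨hq.lift W hfac, hq.surjective.forall.2 fun k u hu => ?_⟩
  have hW : hq.lift W hfac (q k) = lineMap ℂ (F' k) (F k) :=
    congrArg (fun g : C(K, EllTwo →L[ℂ] EllTwo) => g k) (hq.lift_comp W hfac)
  obtain ⟨c, rfl⟩ := BU.exists_eq_smul hu (hF k) (hF0 k)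
  rw [hW, map_smul, lineMap_self _ (hF0 k), smul_eq_zero, or_iff_left (hF0' k)]
  exact ⟨Submodule.smul_mem _ _ (hF' k), fun h => by rw [h, zero_smul]⟩

/-! ### The Moore space -/

/-- The characteristic map of the top cell of the Moore space. -/
def mooreMk (p : ℕ) : C(DiscTwo, MooreSpace p) := ⟨Quotient.mk _, continuous_quotient_mk'⟩

theorem isQuotientMap_mooreMk (p : ℕ) : Topology.IsQuotientMap (mooreMk p) :=
  isQuotientMap_quotient_mk'

/-- The boundary circle of the disc, as a set. -/
def discBoundary : Set DiscTwo := {z | ‖z.1‖ = 1}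

theorem isClosed_discBoundary : IsClosed discBoundary :=
  isClosed_eq (by fun_prop) continuous_const

theorem eq_or_mem_of_mooreMk_eq {p : ℕ} {z w : DiscTwo} (h : mooreMk p z = mooreMk p w) :
    z = w ∨ (z ∈ discBoundary ∧ w ∈ discBoundary) :=
  (Quotient.exact h).imp_right fun h => ⟨h.1, h.2.1⟩

/-- The identification of `discBoundary` with the circle, inverse to `circleToDisc`. -/
def discBoundaryToCircle : C(discBoundary, Circle) :=
  ⟨fun z => ⟨z.1.1, mem_sphere_zero_iff_norm.2 z.2⟩, by fun_prop⟩

theorem circleToDisc_discBoundaryToCircle (z : discBoundary) :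
    circleToDisc (discBoundaryToCircle z) = z := rfl

theorem isClosedEmbedding_circleToDisc : Topology.IsClosedEmbedding circleToDisc :=
  circleToDisc.continuous.isClosedEmbedding fun _ _ h =>
    Circle.ext (congrArg (fun z : DiscTwo => z.1) h)

theorem mooreMk_circleToDisc_eq_iff {p : ℕ} {z w : Circle} :
    mooreMk p (circleToDisc z) = mooreMk p (circleToDisc w) ↔ z = w ∨ z ^ p = w ^ p := by
  have hpow : (z : ℂ) ^ p = (w : ℂ) ^ p ↔ z ^ p = w ^ p := by
    rw [← Circle.coe_pow, ← Circle.coe_pow, Circle.ext_iff]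
  refine Quotient.eq.trans (or_congr isClosedEmbedding_circleToDisc.injective.eq_iff ?_)
  change ‖(z : ℂ)‖ = 1 ∧ ‖(w : ℂ)‖ = 1 ∧ (z : ℂ) ^ p = (w : ℂ) ^ p ↔ _
  rw [hpow]
  exact ⟨fun h => h.2.2, fun h => ⟨Circle.norm_coe z, Circle.norm_coe w, h⟩⟩

theorem exists_mooreCircle (p : ℕ) :
    ∃ c : C(Circle, MooreSpace p), (∀ z, c (z ^ p) = mooreMk p (circleToDisc z)) ∧
      ∀ w, ∃ z, c w = mooreMk p (circleToDisc z) := by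
  rcases Nat.eq_zero_or_pos p with rfl | hp
  · refine ⟨ContinuousMap.const _ (mooreMk 0 (circleToDisc 1)), fun z => ?_, fun _ => ⟨1, rfl⟩⟩
    exact mooreMk_circleToDisc_eq_iff.2 (Or.inr (by simp))
  · have : NeZero p := ⟨hp.ne'⟩
    let P : C(Circle, Circle) := ⟨fun z => z ^ p, by fun_prop⟩
    have hP : Topology.IsQuotientMap P := (Circle.isQuotientCoveringMap_npow p).toIsQuotientMap
    have hfac : Function.FactorsThrough ((mooreMk p).comp circleToDisc) P := fun z w h =>
      mooreMk_circleToDisc_eq_iff.2 (Or.inr h)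
    have h (z : Circle) : hP.lift _ hfac (z ^ p) = mooreMk p (circleToDisc z) :=
      congrArg (fun g : C(Circle, MooreSpace p) => g z) (hP.lift_comp _ hfac)
    exact ⟨hP.lift _ hfac, h, hP.surjective.forall.2 fun z => ⟨z, h z⟩⟩

/-- The `1`-skeleton `S¹ → P²(p)`. It is constant for `p = 0`, where `MooreSpace 0` is the sphere
`D² / S¹` rather than `S¹ ∨ S²`. -/
noncomputable def mooreCircle (p : ℕ) : C(Circle, MooreSpace p) := (exists_mooreCircle p).choose

theorem mooreCircle_pow {p : ℕ} (z : Circle) :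
    mooreCircle p (z ^ p) = mooreMk p (circleToDisc z) := (exists_mooreCircle p).choose_spec.1 z

theorem exists_mooreCircle_eq {p : ℕ} (w : Circle) :
    ∃ z, mooreCircle p w = mooreMk p (circleToDisc z) := (exists_mooreCircle p).choose_spec.2 w

/-! ### Degrees of bundles on the Moore space -/

section Moore

variable {p n : ℕ}

/-- The clutching function of the bundle `f`, which compares a frame on the disc to a frame on the
circle, has determinant of degree `k`. For a line bundle this is the first Chern class, in the
cellular cohomology `H²(P²(p); ℤ) = ℤ/p`; changing the two frames changes `k` by a multiple
of `p`. -/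
def HasDeg (f : C(MooreSpace p, BU n)) (k : ℤ) : Prop :=
  ∃ (F : C(DiscTwo, Fin n → EllTwo)) (G : C(Circle, Fin n → EllTwo)),
    (∀ z, IsFrame (f (mooreMk p z)) (F z)) ∧ (∀ w, IsFrame (f (mooreCircle p w)) (G w)) ∧
      IsDeg (fun z => (crossGram ℂ (G (z ^ p)) (F (circleToDisc z))).det) k

theorem isFrame_pow {f : C(MooreSpace p, BU n)} {G : C(Circle, Fin n → EllTwo)}
    (hG : ∀ w, IsFrame (f (mooreCircle p w)) (G w)) (z : Circle) :
    IsFrame (f (mooreMk p (circleToDisc z))) (G (z ^ p)) :=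
  mooreCircle_pow (p := p) z ▸ hG (z ^ p)

theorem exists_hasDeg (f : C(MooreSpace p, BU n)) : ∃ k, HasDeg f k := by
  obtain ⟨F, hF⟩ := exists_frame (f.comp (mooreMk p))
  obtain ⟨G, hG⟩ := exists_frame_circle (f.comp (mooreCircle p))
  obtain ⟨k, hk⟩ := exists_isDeg
    (φ := fun z => (crossGram ℂ (G (z ^ p)) (F (circleToDisc z))).det)
    (continuous_det_crossGram (by fun_prop) (by fun_prop))
    fun z => (isFrame_pow hG z).det_crossGram_ne_zero (hF _)
  exact ⟨k, F, G, hF, hG, hk⟩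

theorem HasDeg.congr {f f' : C(MooreSpace p, BU n)} {k k' : ℤ} (hk : HasDeg f k)
    (hk' : HasDeg f' k') (h : BundleIso f f') : (k : ZMod p) = k' := by
  obtain ⟨F, G, hF, hG, hφ⟩ := hk
  obtain ⟨F', G', hF', hG', hφ'⟩ := hk'
  obtain ⟨T, hT⟩ := h
  let TF : C(DiscTwo, Fin n → EllTwo) := ⟨fun z j => T (mooreMk p z) (F z j), by fun_prop⟩
  let TG : C(Circle, Fin n → EllTwo) := ⟨fun w j => T (mooreCircle p w) (G w j), by fun_prop⟩
  have hTF (z) : IsFrame (f' (mooreMk p z)) (TF z) := (hF z).map (hT _)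
  have hTG (w) : IsFrame (f' (mooreCircle p w)) (TG w) := (hG w).map (hT _)
  obtain ⟨m, hm⟩ := exists_isDeg (continuous_det_crossGram (by fun_prop) (by fun_prop))
    fun w => (hG w).det_crossGram_ne_zero (hG w)
  obtain ⟨m', hm'⟩ := exists_isDeg (continuous_det_crossGram (by fun_prop) (by fun_prop))
    fun w => (hG' w).det_crossGram_ne_zero (hTG w)
  have hdisc := isDeg_zero_of_disc (continuous_det_crossGram (by fun_prop) (by fun_prop))
    fun z => (hTF z).det_crossGram_ne_zero (hTF z)
  have hdisc' := isDeg_zero_of_disc (continuous_det_crossGram (by fun_prop) (by fun_prop))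
    fun z => (hTF z).det_crossGram_ne_zero (hF' z)
  -- Frame changes over the circle are precomposed with `z ↦ z ^ p`, so they contribute multiples
  -- of `p`; those over the disc contribute nothing.
  have hdeg : k' + p * m + 0 = p * m' + k + 0 := by
    refine ((hφ'.mul (hm.comp_pow p)).mul hdisc).unique ?_
    convert ((hm'.comp_pow p).mul hφ).mul hdisc' using 2 with z
    obtain ⟨h, hh⟩ := (hF (circleToDisc z)).exists_eq_sum (isFrame_pow hG z)
    obtain ⟨a, ha⟩ := (hF' (circleToDisc z)).exists_eq_sum (hTF (circleToDisc z))
    have hTh (j) : TF (circleToDisc z) j = ∑ i, h i j • TG (z ^ p) i := by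
      change T (mooreMk p (circleToDisc z)) (F (circleToDisc z) j) =
        ∑ i, h i j • T (mooreCircle p (z ^ p)) (G (z ^ p) i)
      simp only [hh, mooreCircle_pow, map_sum, map_smul]
    rw [det_crossGram_of_eq_sum ha, det_crossGram_of_eq_sum hTh, det_crossGram_of_eq_sum hh,
      det_crossGram_of_eq_sum ha]
    ring
  simpa using (congrArg (fun m : ℤ => (m : ZMod p)) hdeg).symm

/-- The degree of a bundle on the Moore space, that is, its first Chern class. -/
noncomputable def mooreDegree (f : C(MooreSpace p, BU n)) : ZMod p := (exists_hasDeg f).choose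

theorem BundleIso.mooreDegree_eq {f f' : C(MooreSpace p, BU n)} (h : BundleIso f f') :
    mooreDegree f = mooreDegree f' :=
  (exists_hasDeg f).choose_spec.congr (exists_hasDeg f').choose_spec h

theorem HasDeg.mooreDegree_eq {f : C(MooreSpace p, BU n)} {k : ℤ} (h : HasDeg f k) :
    mooreDegree f = k :=
  (exists_hasDeg f).choose_spec.congr h (BundleIso.refl f)

theorem HasDeg.bundleSum {m : ℕ} {f : C(MooreSpace p, BU m)} {g : C(MooreSpace p, BU n)}
    {k l : ℤ} (hk : HasDeg f k) (hl : HasDeg g l) : HasDeg (bundleSum f g) (k + l) := by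
  obtain ⟨F, G, hF, hG, hφ⟩ := hk
  obtain ⟨F', G', hF', hG', hφ'⟩ := hl
  refine ⟨⟨_, continuous_append_even_odd F.continuous F'.continuous⟩,
    ⟨_, continuous_append_even_odd G.continuous G'.continuous⟩, fun z => (hF z).append (hF' z),
    fun w => (hG w).append (hG' w), ?_⟩
  convert hφ.mul hφ' using 2 with z
  exact det_crossGram_even_odd _ _ _ _

theorem mooreDegree_bundleSum {m : ℕ} (f : C(MooreSpace p, BU m)) (g : C(MooreSpace p, BU n)) :
    mooreDegree (bundleSum f g) = mooreDegree f + mooreDegree g := by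
  obtain ⟨k, hk⟩ := exists_hasDeg f
  obtain ⟨l, hl⟩ := exists_hasDeg g
  rw [(hk.bundleSum hl).mooreDegree_eq, hk.mooreDegree_eq, hl.mooreDegree_eq, Int.cast_add]

theorem mooreDegree_trivialBundle : mooreDegree (trivialBundle (MooreSpace p) n) = 0 := by
  obtain ⟨b, hb⟩ := exists_isFrame (basePointBU n)
  have h : HasDeg (trivialBundle (MooreSpace p) n) 0 :=
    ⟨ContinuousMap.const _ b, ContinuousMap.const _ b, fun _ => hb, fun _ => hb,
      isDeg_zero_of_disc (ψ := fun _ => (crossGram ℂ b b).det) continuous_const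
        fun _ => hb.det_crossGram_ne_zero hb⟩
  rw [h.mooreDegree_eq, Int.cast_zero]

theorem exists_section_moore (hn : 2 ≤ n) (f : C(MooreSpace p, BU n)) :
    ∃ S : C(MooreSpace p, EllTwo), (∀ x, S x ∈ (f x).1.range) ∧ ∀ x, S x ≠ 0 := by
  obtain ⟨s, hs, hs0⟩ := exists_section_circle (by omega) (f.comp (mooreCircle p))
  have hs' (z : discBoundary) : s (discBoundaryToCircle z ^ p) ∈ (f (mooreMk p z)).1.range := by
    rw [← circleToDisc_discBoundaryToCircle, ← mooreCircle_pow]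
    exact hs _
  obtain ⟨S, hS, hS0, -⟩ := exists_section_extension (E := ℂ) (K := DiscTwo)
    ⟨Subtype.val, continuous_subtype_val⟩ Subtype.val_injective (isQuotientMap_mooreMk p)
    isClosed_discBoundary (fun _ _ => eq_or_mem_of_mooreMk_eq) (n := n)
    (by rw [Complex.finrank_real_complex]; omega) f
    (s.comp ⟨fun z => discBoundaryToCircle z ^ p, by fun_prop⟩) hs' (fun _ => hs0 _)
    fun z w h => by
      rcases mooreMk_circleToDisc_eq_iff (z := discBoundaryToCircle z)
        (w := discBoundaryToCircle w) |>.1 h with h | h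
      exacts [congrArg (fun z => s (z ^ p)) h, congrArg s h]
  exact ⟨S, hS, hS0⟩

theorem hasDeg_one_iff {f : C(MooreSpace p, BU 1)} {k : ℤ} :
    HasDeg f k ↔ ∃ (F : C(DiscTwo, EllTwo)) (G : C(Circle, EllTwo)),
      ((∀ z, F z ∈ (f (mooreMk p z)).1.range) ∧ ∀ z, F z ≠ 0) ∧
      ((∀ w, G w ∈ (f (mooreCircle p w)).1.range) ∧ ∀ w, G w ≠ 0) ∧
      IsDeg (fun z => inner ℂ (G (z ^ p)) (F (circleToDisc z))) k := by
  constructor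
  · rintro ⟨F, G, hF, hG, h⟩
    refine ⟨⟨fun z => F z 0, by fun_prop⟩, ⟨fun w => G w 0, by fun_prop⟩,
      ⟨fun z => (hF z).1 0, fun z => (hF z).2.ne_zero 0⟩,
      ⟨fun w => (hG w).1 0, fun w => (hG w).2.ne_zero 0⟩, ?_⟩
    convert h using 2 with z
    rw [Matrix.det_fin_one]
    rfl
  · rintro ⟨F, G, ⟨hF, hF0⟩, ⟨hG, hG0⟩, h⟩
    refine ⟨⟨fun z _ => F z, by fun_prop⟩, ⟨fun w _ => G w, by fun_prop⟩,
      fun z => isFrame_one (hF z) (hF0 z), fun w => isFrame_one (hG w) (hG0 w), ?_⟩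
    convert h using 2 with z
    rw [Matrix.det_fin_one]
    rfl

/-! ### Classification of bundles on the Moore space -/

theorem IsDeg.conj {φ : Circle → ℂ} {k : ℤ} (h : IsDeg φ k) :
    IsDeg (fun z => (starRingEnd ℂ) (φ z)) (-k) := by
  obtain ⟨L, hL⟩ := h
  refine ⟨⟨fun z => (starRingEnd ℂ) (L z), by fun_prop⟩, fun z => ?_⟩
  change (starRingEnd ℂ) (φ z) = _
  rw [hL, map_mul, map_zpow₀, ← Complex.exp_conj, ← Circle.coe_inv_eq_conj, Circle.coe_inv,
    inv_zpow']
  rfl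

theorem IsDeg.exists_extension {φ : Circle → ℂ} (h : IsDeg φ 0) :
    ∃ b : C(DiscTwo, ℂ), (∀ z, b z ≠ 0) ∧ ∀ z, b (circleToDisc z) = φ z := by
  obtain ⟨L, hL⟩ := h
  obtain ⟨l, hl⟩ := ContinuousMap.exists_extension' isClosedEmbedding_circleToDisc L
  refine ⟨⟨fun z => Complex.exp (l z), by fun_prop⟩, fun z => Complex.exp_ne_zero _, fun z => ?_⟩
  rw [hL, zpow_zero, one_mul, ← congrFun hl]
  rfl

section LineDegree

variable {E : Type*} [NormedAddCommGroup E] [InnerProductSpace ℂ E] {v w v' w' : Circle → E}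

theorem isDeg_inner_self (hv : Continuous v) (h0 : ∀ z, v z ≠ 0) :
    IsDeg (fun z => inner ℂ (v z) (v z)) 0 := by
  convert isDeg_zero_of_pos (φ := fun z => ‖v z‖ ^ 2) (by fun_prop)
    fun z => pow_pos (norm_pos_iff.2 (h0 z)) 2 using 2 with z
  rw [inner_self_eq_norm_sq_to_K]
  norm_cast

theorem isDeg_of_smul_lineMap_eq_smul (hv : Continuous v) (hv0 : ∀ z, v z ≠ 0)
    (hw' : Continuous w') (hw0' : ∀ z, w' z ≠ 0) {k k' m : ℤ}
    (hk : IsDeg (fun z => inner ℂ (v z) (w z)) k)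
    (hk' : IsDeg (fun z => inner ℂ (v' z) (w' z)) k') {φ a : Circle → ℂ} (hφ : IsDeg φ m)
    (h : ∀ z, φ z • lineMap ℂ (v' z) (v z) (w z) = a z • w' z) : IsDeg a (m + k - k') := by
  have hself := (isDeg_inner_self hv hv0).mul (isDeg_inner_self hw' hw0')
  convert hself.of_mul_eq ((hφ.mul hk).mul hk'.conj) fun z => ?_ using 1
  · ring
  · have hv : inner ℂ (v z) (v z) ≠ (0 : ℂ) := inner_self_ne_zero.2 (hv0 z)
    have hinner := congrArg (inner ℂ (w' z)) (h z)
    simp only [lineMap_apply, inner_smul_right] at hinner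
    rw [inner_conj_symm]
    field_simp at hinner
    linear_combination -hinner

end LineDegree

theorem bundleIso_of_mooreDegree_eq {f f' : C(MooreSpace p, BU 1)}
    (h : mooreDegree f = mooreDegree f') : BundleIso f f' := by
  obtain ⟨k, hk⟩ := exists_hasDeg f
  obtain ⟨k', hk'⟩ := exists_hasDeg f'
  rw [hk.mooreDegree_eq, hk'.mooreDegree_eq, ZMod.intCast_eq_intCast_iff_dvd_sub] at h
  obtain ⟨j, hj⟩ := h
  obtain ⟨F, G, ⟨hF, hF0⟩, ⟨-, hG0⟩, hφ⟩ := hasDeg_one_iff.1 hk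
  obtain ⟨F', G', ⟨hF', hF0'⟩, ⟨hG', -⟩, hφ'⟩ := hasDeg_one_iff.1 hk'
  -- The isomorphism over the circle is twisted by `w ^ j` so that it extends over the disc.
  let T (w : Circle) : EllTwo →L[ℂ] EllTwo := (w : ℂ) ^ j • lineMap ℂ (G' w) (G w)
  have hG'pow (z) : G' (z ^ p) ∈ (f' (mooreMk p (circleToDisc z))).1.range :=
    mooreCircle_pow (p := p) z ▸ hG' (z ^ p)
  have hTF (z) : ∃ a : ℂ, T (z ^ p) (F (circleToDisc z)) = a • F' (circleToDisc z) :=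
    BU.exists_eq_smul (Submodule.smul_mem _ _ (Submodule.smul_mem _ _
      (Submodule.smul_mem _ _ (hG'pow z)))) (hF' _) (hF0' _)
  choose a ha using hTF
  have hdeg : IsDeg a 0 := by
    convert isDeg_of_smul_lineMap_eq_smul (v := fun z => G (z ^ p)) (by fun_prop) (fun _ => hG0 _)
      (w' := fun z => F' (circleToDisc z)) (by fun_prop) (fun _ => hF0' _) hφ hφ'
      ((isDeg_zpow j).comp_pow p) ha using 1
    linarith
  obtain ⟨b, hb0, hba⟩ := hdeg.exists_extension
  refine bundleIso_of_sections (isQuotientMap_mooreMk p) (fun _ _ => eq_or_mem_of_mooreMk_eq)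
    hF hF0 (F' := ⟨fun z => b z • F' z, by fun_prop⟩) (fun z => Submodule.smul_mem _ _ (hF' z))
    (fun z => smul_ne_zero (hb0 z) (hF0' z)) (T := fun z => T (discBoundaryToCircle z ^ p))
    (fun z => ?_) fun z w hzw => ?_
  · exact (ha (discBoundaryToCircle z)).trans (by rw [← hba]; rfl)
  · rcases mooreMk_circleToDisc_eq_iff (z := discBoundaryToCircle z)
      (w := discBoundaryToCircle w) |>.1 hzw with h | h <;> simp only [h]

theorem homotopic_of_mooreDegree_eq (hn : 1 ≤ n) {f f' : C(MooreSpace p, BU n)}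
    (h : mooreDegree f = mooreDegree f') : Homotopic f f' := by
  induction n, hn using Nat.le_induction with
  | base => exact (bundleIso_of_mooreDegree_eq h).homotopic
  | succ n hn ih =>
    obtain ⟨s, hs, hs0⟩ := exists_section_moore (by omega) f
    obtain ⟨s', hs', hs0'⟩ := exists_section_moore (by omega) f'
    obtain ⟨g, hg⟩ := exists_bundleSum_of_section f s hs hs0
    obtain ⟨g', hg'⟩ := exists_bundleSum_of_section f' s' hs' hs0'
    have hdeg : mooreDegree g = mooreDegree g' := by
      rw [← hg.mooreDegree_eq, ← hg'.mooreDegree_eq, mooreDegree_bundleSum,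
        mooreDegree_bundleSum] at h
      exact add_right_cancel h
    refine (hg.homotopic.symm.trans ?_).trans hg'.homotopic
    exact Homotopic.comp (Homotopic.refl _) ((ih hdeg).prodMk (Homotopic.refl _))

theorem mooreDegree_of_isTensorMap {f g h : C(MooreSpace p, BU 1)} (ht : IsTensorMap f g h) :
    mooreDegree h = mooreDegree f + mooreDegree g := by
  obtain ⟨B, hB⟩ := ht
  obtain ⟨k, hk⟩ := exists_hasDeg f
  obtain ⟨l, hl⟩ := exists_hasDeg g
  rw [hk.mooreDegree_eq, hl.mooreDegree_eq, ← Int.cast_add]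
  refine HasDeg.mooreDegree_eq (hasDeg_one_iff.2 ?_)
  obtain ⟨F, G, ⟨hF, hF0⟩, ⟨hG, hG0⟩, hφ⟩ := hasDeg_one_iff.1 hk
  obtain ⟨F', G', ⟨hF', hF0'⟩, ⟨hG', hG0'⟩, hφ'⟩ := hasDeg_one_iff.1 hl
  have hBF (z) := hB _ _ (hF z) _ (hF' z)
  have hBG (w) := hB _ _ (hG w) _ (hG' w)
  refine ⟨⟨fun z => B (mooreMk p z) (F z) (F' z), by fun_prop⟩,
    ⟨fun w => B (mooreCircle p w) (G w) (G' w), by fun_prop⟩,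
    ⟨fun z => (hBF z).1, fun z => (hBF z).2 (hF0 z) (hF0' z)⟩,
    ⟨fun w => (hBG w).1, fun w => (hBG w).2 (hG0 w) (hG0' w)⟩, ?_⟩
  have hself := (isDeg_inner_self (v := fun z => G (z ^ p)) (by fun_prop) fun _ => hG0 _).mul
    (isDeg_inner_self (v := fun z => G' (z ^ p)) (by fun_prop) fun _ => hG0' _)
  have hselfB := isDeg_inner_self
    (v := fun z => B (mooreCircle p (z ^ p)) (G (z ^ p)) (G' (z ^ p))) (by fun_prop)
    fun _ => (hBG _).2 (hG0 _) (hG0' _)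
  convert hself.of_mul_eq ((hφ.mul hφ').mul hselfB) fun z => ?_ using 1
  · ring
  · obtain ⟨x, hx⟩ := BU.exists_eq_smul (hF (circleToDisc z))
      (mooreCircle_pow (p := p) z ▸ hG (z ^ p)) (hG0 _)
    obtain ⟨y, hy⟩ := BU.exists_eq_smul (hF' (circleToDisc z))
      (mooreCircle_pow (p := p) z ▸ hG' (z ^ p)) (hG0' _)
    simp only [ContinuousMap.coe_mk, hx, hy, mooreCircle_pow, map_smul, smul_apply,
      inner_smul_right]
    ring

end Moore

/-! ### Existence of bundles -/

theorem starProjection_span_singleton_eq_lineMap {𝕜 E : Type*} [RCLike 𝕜] [NormedAddCommGroup E]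
    [InnerProductSpace 𝕜 E] (v : E) : (𝕜 ∙ v).starProjection = lineMap 𝕜 v v := by
  ext u
  rw [Submodule.starProjection_singleton, lineMap_apply, inner_self_eq_norm_sq_to_K, smul_smul,
    div_eq_inv_mul, RCLike.ofReal_pow]

/-- The line spanned by a nonzero vector, as a point of `BU(1)`. -/
noncomputable def lineBU (v : EllTwo) (hv : v ≠ 0) : BU 1 :=
  ⟨(ℂ ∙ v).starProjection, isStarProjection_starProjection, by
    rw [Submodule.range_starProjection, ← Module.finrank_eq_rank, finrank_span_singleton hv]⟩

theorem mem_range_lineBU {v : EllTwo} (hv : v ≠ 0) : v ∈ (lineBU v hv).1.range := by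
  rw [lineBU, Submodule.range_starProjection]
  exact Submodule.mem_span_singleton_self v

theorem continuous_lineBU {Y : Type*} [TopologicalSpace Y] {v : Y → EllTwo} (hv : Continuous v)
    (h0 : ∀ y, v y ≠ 0) : Continuous fun y => lineBU (v y) (h0 y) := by
  refine Continuous.subtype_mk ?_ _
  simp only [starProjection_span_singleton_eq_lineMap]
  exact continuous_lineMap hv hv h0

theorem exists_disc_extension_zpow (k : ℤ) :
    ∃ φ : C(DiscTwo, ℂ), ∀ z, φ (circleToDisc z) = (z : ℂ) ^ k := by
  obtain ⟨m, rfl | rfl⟩ := k.eq_nat_or_neg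
  · exact ⟨⟨fun z => z.1 ^ m, by fun_prop⟩, fun z => (zpow_natCast _ m).symm⟩
  · refine ⟨⟨fun z => (starRingEnd ℂ) z.1 ^ m, by fun_prop⟩, fun z => ?_⟩
    change (starRingEnd ℂ) (z : ℂ) ^ m = _
    rw [← Circle.coe_inv_eq_conj, Circle.coe_inv, zpow_neg, zpow_natCast, inv_pow]

theorem exists_disc_extension_zpow_smul {E : Type*} [AddCommGroup E] [Module ℂ E]
    [TopologicalSpace E] [ContinuousAdd E] [ContinuousSMul ℂ E] {e e' : E}
    (h : LinearIndependent ℂ ![e, e']) (k : ℤ) :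
    ∃ v : C(DiscTwo, E), (∀ z, v z ≠ 0) ∧ ∀ z, v (circleToDisc z) = (z : ℂ) ^ k • e := by
  obtain ⟨φ, hφ⟩ := exists_disc_extension_zpow k
  refine ⟨⟨fun z => φ z • e + (1 - ‖z.1‖ : ℂ) • e', by fun_prop⟩, fun z hz => ?_, fun z => ?_⟩
  · obtain ⟨hφz, hz1⟩ := LinearIndependent.pair_iff.1 h _ _ hz
    have hzA : z ∈ discBoundary := by exact_mod_cast (sub_eq_zero.1 hz1).symm
    have hφA := hφ (discBoundaryToCircle ⟨z, hzA⟩)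
    rw [circleToDisc_discBoundaryToCircle, hφz] at hφA
    exact zpow_ne_zero k (Circle.coe_ne_zero _) hφA.symm
  · change φ (circleToDisc z) • e + (1 - ‖(z : ℂ)‖ : ℂ) • e' = _
    rw [hφ, Circle.norm_coe, Complex.ofReal_one, sub_self, zero_smul, add_zero]

theorem linearIndependent_ellBasis_zero_one : LinearIndependent ℂ ![ellBasis 0, ellBasis 1] := by
  have h : ![ellBasis 0, ellBasis 1] = ellBasis ∘ ((↑) : Fin 2 → ℕ) := by
    ext1 i
    fin_cases i <;> rfl
  rw [h]
  exact ellBasis.orthonormal.linearIndependent.comp _ Fin.val_injective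

theorem exists_hasDeg_line (p : ℕ) (k : ℤ) : ∃ f : C(MooreSpace p, BU 1), HasDeg f k := by
  obtain ⟨v, hv0, hv⟩ := exists_disc_extension_zpow_smul linearIndependent_ellBasis_zero_one k
  have he0 : ellBasis 0 ≠ 0 := ellBasis.orthonormal.ne_zero 0
  let g : C(DiscTwo, BU 1) := ⟨fun z => lineBU (v z) (hv0 z), continuous_lineBU v.continuous hv0⟩
  have hgb (z : Circle) : ellBasis 0 ∈ (g (circleToDisc z)).1.range := by
    rw [← Submodule.smul_mem_iff _ (zpow_ne_zero k (Circle.coe_ne_zero z)), ← hv]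
    exact mem_range_lineBU (hv0 _)
  have hfac : Function.FactorsThrough g (mooreMk p) := fun z w h => by
    rcases eq_or_mem_of_mooreMk_eq h with rfl | ⟨hz, hw⟩
    · rfl
    · exact BU.eq_of_mem_range (hgb (discBoundaryToCircle ⟨z, hz⟩))
        (hgb (discBoundaryToCircle ⟨w, hw⟩)) he0
  have hlift (z) : (isQuotientMap_mooreMk p).lift g hfac (mooreMk p z) = g z :=
    congrArg (fun g : C(DiscTwo, BU 1) => g z) ((isQuotientMap_mooreMk p).lift_comp g hfac)
  refine ⟨(isQuotientMap_mooreMk p).lift g hfac, hasDeg_one_iff.2 ⟨v,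
    ContinuousMap.const _ (ellBasis 0), ⟨fun z => ?_, hv0⟩, ⟨fun w => ?_, fun _ => he0⟩, ?_⟩⟩
  · rw [hlift]
    exact mem_range_lineBU (hv0 z)
  · obtain ⟨z, hz⟩ := exists_mooreCircle_eq (p := p) w
    rw [hz, hlift]
    exact hgb z
  · convert isDeg_zpow k using 2 with z
    rw [hv, ContinuousMap.const_apply, inner_smul_right, inner_self_eq_norm_sq_to_K,
      ellBasis.orthonormal.1 0, RCLike.ofReal_one, one_pow, mul_one]

theorem exists_mooreDegree_eq {p n : ℕ} (hn : 1 ≤ n) (d : ZMod p) :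
    ∃ f : C(MooreSpace p, BU n), mooreDegree f = d := by
  obtain ⟨k, rfl⟩ := ZMod.intCast_surjective d
  obtain ⟨m, rfl⟩ := Nat.exists_eq_add_of_le hn
  obtain ⟨f, hf⟩ := exists_hasDeg_line p k
  refine ⟨bundleSum f (trivialBundle _ m), ?_⟩
  rw [mooreDegree_bundleSum, mooreDegree_trivialBundle, hf.mooreDegree_eq, add_zero]

/-! ### Tensor products of line bundles -/

theorem summable_geometric_smulRight {𝕜 E F : Type*} [RCLike 𝕜] [NormedAddCommGroup E]
    [InnerProductSpace 𝕜 E] [NormedAddCommGroup F] [NormedSpace 𝕜 F] [CompleteSpace F]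
    {b : ℕ → E} (hb : ∀ i, ‖b i‖ = 1) {S : ℕ → F} (hS : ∀ i, ‖S i‖ ≤ 1) :
    Summable fun i => (2 : 𝕜)⁻¹ ^ i • (innerSL 𝕜 (b i)).smulRight (S i) := by
  refine Summable.of_norm_bounded (g := fun i => (2 : ℝ)⁻¹ ^ i)
    (summable_geometric_of_lt_one (by norm_num) (by norm_num)) fun i => ?_
  rw [norm_smul, ContinuousLinearMap.norm_smulRight_apply, innerSL_apply_norm,
    hb, one_mul, norm_pow, norm_inv, RCLike.norm_ofNat]
  exact mul_le_of_le_one_right (by positivity) (hS i)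

/-- The isometry `e j ↦ e (j + i)` of `ℓ²(ℕ)`: multiplication by `X ^ i`, when vectors are read as
power series. -/
noncomputable def shiftEmb (i : ℕ) : EllTwo →ₗᵢ[ℂ] EllTwo :=
  ellEmb (fun j => j + i) (add_left_injective i)

/-- A continuous bilinear product on `ℓ²(ℕ)` without zero divisors: the multiplication of power
series, the coefficients of the first factor being weighted by `2 ^ (-i)` to make it converge. -/
noncomputable def convMul : EllTwo →L[ℂ] EllTwo →L[ℂ] EllTwo :=
  ∑' i : ℕ, (2 : ℂ)⁻¹ ^ i •
    (innerSL ℂ (ellBasis i)).smulRight (shiftEmb i).toContinuousLinearMap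

theorem hasSum_convMul_apply (u w : EllTwo) (k : ℕ) :
    HasSum (fun i => (2 : ℂ)⁻¹ ^ i * (u i * shiftEmb i w k)) (convMul u w k) := by
  have hsum := (((summable_geometric_smulRight ellBasis.orthonormal.1 fun i =>
    (shiftEmb i).norm_toContinuousLinearMap_le).hasSum.mapL
      (ContinuousLinearMap.apply ℂ _ u)).mapL (ContinuousLinearMap.apply ℂ _ w)).mapL
        (innerSL ℂ (ellBasis k))
  rw [← ellBasis_repr]
  refine (congrArg (HasSum · _) (funext fun i => ?_)).mpr hsum
  rw [← ellBasis_repr _ k, ← ellBasis_repr u i, ← inner_smul_right, ← inner_smul_right]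
  rfl

theorem shiftEmb_apply_eq_zero {w : EllTwo} {b i k : ℕ} (hw : ∀ j < b, w j = 0) (hk : k < b + i) :
    shiftEmb i w k = 0 := by
  by_cases hik : i ≤ k
  · obtain ⟨j, rfl⟩ := Nat.exists_eq_add_of_le' hik
    exact (ellEmb_apply_apply _ (add_left_injective i) w j).trans (hw j (by lia))
  · exact ellEmb_apply_of_forall_ne _ (add_left_injective i) w k fun j => by lia

theorem convMul_apply_add {u w : EllTwo} {a b : ℕ} (hu : ∀ i < a, u i = 0)
    (hw : ∀ j < b, w j = 0) : convMul u w (b + a) = (2 : ℂ)⁻¹ ^ a * (u a * w b) := by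
  have hshift : shiftEmb a w (b + a) = w b := ellEmb_apply_apply _ (add_left_injective a) w b
  rw [← hshift]
  refine (hasSum_convMul_apply u w (b + a)).unique (hasSum_single a fun i hi => ?_)
  rcases hi.lt_or_gt with hi | hi
  · rw [hu i hi, zero_mul, mul_zero]
  · rw [shiftEmb_apply_eq_zero hw (by lia), mul_zero, mul_zero]

theorem exists_lowest_coordinate {u : EllTwo} (hu : u ≠ 0) : ∃ a, u a ≠ 0 ∧ ∀ i < a, u i = 0 := by
  classical
  have hex : ∃ a, u a ≠ 0 := by
    by_contra! h
    exact hu (lp.ext (funext h))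
  exact ⟨Nat.find hex, Nat.find_spec hex, fun i hi => not_not.1 (Nat.find_min hex hi)⟩

theorem convMul_ne_zero {u w : EllTwo} (hu : u ≠ 0) (hw : w ≠ 0) : convMul u w ≠ 0 := by
  obtain ⟨a, ha, hlta⟩ := exists_lowest_coordinate hu
  obtain ⟨b, hb, hltb⟩ := exists_lowest_coordinate hw
  intro h
  have hcoord := convMul_apply_add hlta hltb
  rw [h] at hcoord
  exact mul_ne_zero (pow_ne_zero _ (by norm_num)) (mul_ne_zero ha hb) hcoord.symm

theorem BU.exists_mem_range_ne_zero (P : BU 1) : ∃ u ∈ P.1.range, u ≠ 0 := by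
  obtain ⟨F, hF⟩ := exists_isFrame P
  exact ⟨F 0, hF.1 0, hF.2.ne_zero 0⟩

theorem exists_isTensorMap {X : Type} [TopologicalSpace X] (f g : C(X, BU 1)) :
    ∃ h : C(X, BU 1), IsTensorMap f g h := by
  choose u hu hu0 using fun x => (f x).exists_mem_range_ne_zero
  choose w hw hw0 using fun x => (g x).exists_mem_range_ne_zero
  let h (x : X) : BU 1 := lineBU _ (convMul_ne_zero (hu0 x) (hw0 x))
  have hmem (x) : ∀ a ∈ (f x).1.range, ∀ b ∈ (g x).1.range, convMul a b ∈ (h x).1.range := by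
    intro a ha b hb
    obtain ⟨c, rfl⟩ := BU.exists_eq_smul ha (hu x) (hu0 x)
    obtain ⟨d, rfl⟩ := BU.exists_eq_smul hb (hw x) (hw0 x)
    rw [map_smul, map_smul, smul_apply]
    exact Submodule.smul_mem _ _ (Submodule.smul_mem _ _ (mem_range_lineBU _))
  -- `u` and `w` need not be continuous; near `x₀` project their values at `x₀` to the fibers.
  have hcont : Continuous h := continuous_iff_continuousAt.2 fun x₀ => by
    let v (x : X) : EllTwo := convMul ((f x).1 (u x₀)) ((g x).1 (w x₀))
    have hv : Continuous v := by fun_prop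
    have hv0 : v x₀ ≠ 0 := by
      change convMul ((f x₀).1 (u x₀)) ((g x₀).1 (w x₀)) ≠ 0
      rw [(f x₀).mem_range_iff.1 (hu x₀), (g x₀).mem_range_iff.1 (hw x₀)]
      exact convMul_ne_zero (hu0 x₀) (hw0 x₀)
    refine Topology.IsInducing.subtypeVal.continuousAt_iff.2
      ((continuousAt_lineMap (𝕜 := ℂ) hv.continuousAt hv.continuousAt hv0).congr ?_)
    filter_upwards [hv.continuousAt.eventually_ne hv0] with x hx
    rw [← starProjection_span_singleton_eq_lineMap]
    exact congrArg Subtype.val (BU.eq_of_mem_range (mem_range_lineBU hx)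
      (hmem x _ ((f x).apply_mem _) _ ((g x).apply_mem _)) hx)
  exact ⟨⟨h, hcont⟩, ContinuousMap.const _ convMul,
    fun x a ha b hb => ⟨hmem x a ha b hb, convMul_ne_zero⟩⟩

/-! ### The group structures -/

theorem htpyClass_eq_iff {X Y : Type} [TopologicalSpace X] [TopologicalSpace Y] {f g : C(X, Y)} :
    htpyClass f = htpyClass g ↔ Homotopic f g :=
  ⟨fun h => Quotient.exact h, fun h => Quotient.sound h⟩

theorem htpyClass_surjective {X Y : Type} [TopologicalSpace X] [TopologicalSpace Y] :
    Function.Surjective (htpyClass (X := X) (Y := Y)) := Quotient.exists_rep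

section Group

variable {X : Type} [TopologicalSpace X] {p : ℕ}

/-- The degree of a class of bundles on `X`, measured along a map `j` from a Moore space. -/
noncomputable def classDegree (j : C(MooreSpace p, X)) {n : ℕ} :
    HtpyClasses X (BU n) → ZMod p :=
  Quotient.lift (fun f : C(X, BU n) => mooreDegree (f.comp j)) fun _ _ h =>
    (bundleIso_of_homotopic (Homotopic.comp h (Homotopic.refl j))).mooreDegree_eq

theorem classDegree_htpyClass (j : C(MooreSpace p, X)) {n : ℕ} (f : C(X, BU n)) :
    classDegree j (htpyClass f) = mooreDegree (f.comp j) := rfl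

theorem classDegree_classSum (j : C(MooreSpace p, X)) {m n : ℕ} (α : HtpyClasses X (BU m))
    (β : HtpyClasses X (BU n)) :
    classDegree j (classSum α β) = classDegree j α + classDegree j β := by
  obtain ⟨f, rfl⟩ := htpyClass_surjective α
  obtain ⟨g, rfl⟩ := htpyClass_surjective β
  exact mooreDegree_bundleSum (f.comp j) (g.comp j)

theorem classDegree_trivialClass (j : C(MooreSpace p, X)) (n : ℕ) :
    classDegree j (trivialClass X n) = 0 :=
  mooreDegree_trivialBundle

theorem classDegree_of_isTensorProd (j : C(MooreSpace p, X)) {α β γ : HtpyClasses X (BU 1)}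
    (h : IsTensorProd α β γ) : classDegree j γ = classDegree j α + classDegree j β := by
  obtain ⟨f, g, h, rfl, rfl, rfl, B, hB⟩ := h
  exact mooreDegree_of_isTensorMap ⟨B.comp j, fun x => hB (j x)⟩

theorem isTensorProd_iff_classDegree {j : C(MooreSpace p, X)}
    (hinj : Function.Injective (classDegree j (n := 1))) {α β γ : HtpyClasses X (BU 1)} :
    IsTensorProd α β γ ↔ classDegree j γ = classDegree j α + classDegree j β := by
  refine ⟨classDegree_of_isTensorProd j, fun h => ?_⟩
  obtain ⟨f, rfl⟩ := htpyClass_surjective α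
  obtain ⟨g, rfl⟩ := htpyClass_surjective β
  obtain ⟨t, ht⟩ := exists_isTensorMap f g
  have hprod : IsTensorProd (htpyClass f) (htpyClass g) (htpyClass t) :=
    ⟨f, g, t, rfl, rfl, rfl, ht⟩
  rwa [hinj (h.trans (classDegree_of_isTensorProd j hprod).symm)]

theorem isStableSum_iff_classDegree {j : C(MooreSpace p, X)} {n : ℕ}
    (hinj : Function.Injective (classDegree j (n := n + n + 0))) {α β γ : HtpyClasses X (BU n)} :
    IsStableSum α β γ ↔ classDegree j γ = classDegree j α + classDegree j β := by
  have hsum (k) : classDegree j (classSum (classSum α β) (trivialClass X k)) =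
      classDegree j (classSum (classSum γ (trivialClass X n)) (trivialClass X k)) ↔
      classDegree j γ = classDegree j α + classDegree j β := by
    simp only [classDegree_classSum, classDegree_trivialClass, add_zero]
    exact eq_comm
  exact ⟨fun ⟨k, hk⟩ => (hsum k).1 (congrArg (classDegree j) hk), fun h => ⟨0, hinj ((hsum 0).2 h)⟩⟩

theorem isClassAdd_iff_classDegree {j : C(MooreSpace p, X)}
    (hinj : ∀ m, 1 ≤ m → Function.Injective (classDegree j (n := m))) {n : ℕ} (hn : 1 ≤ n)
    {α β γ : HtpyClasses X (BU n)} :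
    IsClassAdd n α β γ ↔ classDegree j γ = classDegree j α + classDegree j β := by
  match n, hn with
  | 1, _ => exact isTensorProd_iff_classDegree (hinj 1 le_rfl)
  | _ + 2, _ => exact isStableSum_iff_classDegree (hinj _ (by lia))

theorem exists_bundleGroup (j : C(MooreSpace p, X))
    (hbij : ∀ m, 1 ≤ m → Function.Bijective (classDegree j (n := m))) {n : ℕ} (hn : 1 ≤ n) :
    ∃ (_ : AddCommGroup (HtpyClasses X (BU n))) (e : HtpyClasses X (BU n) ≃+ ZMod p),
      IsBundleGroup X n ∧ ∀ α, e α = classDegree j α := by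
  let e := Equiv.ofBijective _ (hbij n hn)
  refine ⟨e.addCommGroup, @Equiv.addEquiv _ _ e _, fun α β γ => ?_, fun _ => rfl⟩
  rw [isClassAdd_iff_classDegree (fun m hm => (hbij m hm).injective) hn, ← e.injective.eq_iff]
  exact Eq.congr_right (e.apply_symm_apply _)

theorem classDegree_homeomorph_bijective (h : MooreSpace p ≃ₜ X) {n : ℕ} (hn : 1 ≤ n) :
    Function.Bijective (classDegree (h : C(MooreSpace p, X)) (n := n)) := by
  constructor
  · intro α β hαβ
    obtain ⟨f, rfl⟩ := htpyClass_surjective α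
    obtain ⟨g, rfl⟩ := htpyClass_surjective β
    have hfg := (homotopic_of_mooreDegree_eq hn hαβ).comp
      (Homotopic.refl (h.symm : C(X, MooreSpace p)))
    simpa only [ContinuousMap.comp_assoc, Homeomorph.toContinuousMap_comp_symm,
      ContinuousMap.comp_id, ← htpyClass_eq_iff] using hfg
  · intro d
    obtain ⟨f, hf⟩ := exists_mooreDegree_eq hn d
    refine ⟨htpyClass (f.comp (h.symm : C(X, MooreSpace p))), ?_⟩
    rw [classDegree_htpyClass, ContinuousMap.comp_assoc, Homeomorph.symm_comp_toContinuousMap,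
      ContinuousMap.comp_id, hf]

end Group

theorem classDegree_moore_bijective {p n : ℕ} (hn : 1 ≤ n) :
    Function.Bijective (classDegree (ContinuousMap.id (MooreSpace p)) (n := n)) :=
  classDegree_homeomorph_bijective (Homeomorph.refl _) hn

/-! ### The sphere -/

theorem HasDeg.pinchMap {n : ℕ} {f : C(SphereTwo, BU n)} {k : ℤ}
    (h : HasDeg (f.comp (pinchMap 0)) k) (p : ℕ) : HasDeg (f.comp (pinchMap p)) k := by
  obtain ⟨F, G, hF, hG, hφ⟩ := h
  refine ⟨F, ContinuousMap.const _ (G 1), hF, fun w => ?_, by simpa using hφ⟩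
  obtain ⟨z, hz⟩ := exists_mooreCircle_eq (p := p) w
  have hG1 := isFrame_pow hG z
  rw [pow_zero] at hG1
  rw [ContinuousMap.comp_apply, hz]
  exact hG1

theorem mooreDegree_pinchMap {n : ℕ} (f : C(SphereTwo, BU n)) (p : ℕ) :
    mooreDegree (f.comp (pinchMap p)) = Int.cast (mooreDegree (f.comp (pinchMap 0))) := by
  obtain ⟨k, hk⟩ := exists_hasDeg (f.comp (pinchMap 0))
  rw [(hk.pinchMap p).mooreDegree_eq, hk.mooreDegree_eq]
  rfl

theorem discToSphereTwo_eq_iff {z : DiscTwo} {y : SphereTwo} : discToSphereTwo z = y ↔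
    2 * √(1 - ‖z.1‖ ^ 2) * z.1.re = y.1 0 ∧ 2 * √(1 - ‖z.1‖ ^ 2) * z.1.im = y.1 1 ∧
      2 * ‖z.1‖ ^ 2 - 1 = y.1 2 := by
  rw [Subtype.ext_iff, PiLp.ext_iff]
  exact Fin.forall_fin_succ.trans (and_congr_right' Fin.forall_fin_two)

theorem exists_two_mul_sqrt_eq {a b c : ℝ} (h : a ^ 2 + b ^ 2 + c ^ 2 = 1) (hc : c < 1) :
    ∃ z : ℂ, ‖z‖ ≤ 1 ∧ 2 * √(1 - ‖z‖ ^ 2) * z.re = a ∧ 2 * √(1 - ‖z‖ ^ 2) * z.im = b ∧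
      2 * ‖z‖ ^ 2 - 1 = c := by
  obtain ⟨s, hs0, hs⟩ : ∃ s : ℝ, 0 < s ∧ s ^ 2 = (1 - c) / 2 :=
    ⟨√((1 - c) / 2), Real.sqrt_pos.2 (by linarith), Real.sq_sqrt (by linarith)⟩
  let z : ℂ := ⟨a / (2 * s), b / (2 * s)⟩
  have hnorm : ‖z‖ ^ 2 = (1 + c) / 2 := by
    rw [Complex.sq_norm, Complex.normSq_apply]
    simp only [z]
    field_simp
    rw [hs]
    nlinarith
  have hsqrt : √(1 - ‖z‖ ^ 2) = s := by
    rw [hnorm, Real.sqrt_eq_iff_mul_self_eq_of_pos hs0]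
    nlinarith
  refine ⟨z, (sq_le_one_iff₀ (norm_nonneg z)).1 (by linarith), ?_, ?_, by linarith⟩ <;>
  · rw [hsqrt]
    exact mul_div_cancel₀ _ (by positivity)

theorem discToSphereTwo_surjective : Function.Surjective discToSphereTwo := by
  intro y
  have hy := mem_sphere_zero_iff_norm.1 y.2
  rw [EuclideanSpace.norm_eq, Real.sqrt_eq_one, Fin.sum_univ_three] at hy
  simp only [Real.norm_eq_abs, sq_abs] at hy
  have hy2 : y.1 2 ≤ 1 := by nlinarith
  rcases hy2.eq_or_lt with hc | hc
  · refine ⟨circleToDisc 1, discToSphereTwo_eq_iff.2 ?_⟩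
    have hy0 : y.1 0 = 0 := by nlinarith
    have hy1 : y.1 1 = 0 := by nlinarith
    rw [hc, hy0, hy1]
    have h1 : ((circleToDisc 1 : DiscTwo) : ℂ) = 1 := Circle.coe_one
    norm_num [h1]
  · obtain ⟨z, hz, h⟩ := exists_two_mul_sqrt_eq hy hc
    exact ⟨⟨z, mem_closedBall_zero_iff.2 hz⟩, discToSphereTwo_eq_iff.2 h⟩

theorem eq_or_norm_eq_one_of_discToSphereTwo_eq {z w : DiscTwo}
    (h : discToSphereTwo z = discToSphereTwo w) : z = w ∨ (‖z.1‖ = 1 ∧ ‖w.1‖ = 1) := by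
  obtain ⟨hre, him, hsq⟩ := discToSphereTwo_eq_iff.1 h
  change _ = 2 * √(1 - ‖w.1‖ ^ 2) * w.1.re at hre
  change _ = 2 * √(1 - ‖w.1‖ ^ 2) * w.1.im at him
  change _ = 2 * ‖w.1‖ ^ 2 - 1 at hsq
  have hnorm : ‖z.1‖ = ‖w.1‖ :=
    (sq_eq_sq₀ (norm_nonneg _) (norm_nonneg _)).1 (by linarith)
  rcases z.norm_le.eq_or_lt with hz | hz
  · exact Or.inr ⟨hz, hnorm ▸ hz⟩
  · left
    rw [← hnorm] at hre him
    have hs : 2 * √(1 - ‖z.1‖ ^ 2) ≠ 0 := by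
      have : 0 < √(1 - ‖z.1‖ ^ 2) := Real.sqrt_pos.2 (by nlinarith [norm_nonneg z.1])
      positivity
    exact Subtype.ext (Complex.ext (mul_left_cancel₀ hs hre) (mul_left_cancel₀ hs him))

theorem pinchMap_zero_bijective : Function.Bijective (pinchMap 0) := by
  constructor
  · refine fun x y => Quotient.inductionOn₂ x y fun z w h => ?_
    rcases eq_or_norm_eq_one_of_discToSphereTwo_eq h with rfl | ⟨hz, hw⟩
    · rfl
    · exact Quotient.sound (Or.inr ⟨hz, hw, by simp⟩)
  · intro y
    obtain ⟨z, hz⟩ := discToSphereTwo_surjective y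
    exact ⟨mooreMk 0 z, hz⟩

/-- The sphere is the Moore space of the constant map of the circle. -/
noncomputable def pinchHomeomorph : MooreSpace 0 ≃ₜ SphereTwo :=
  Continuous.homeoOfEquivCompactToT2 (f := Equiv.ofBijective _ pinchMap_zero_bijective)
    (pinchMap 0).continuous

theorem classDegree_sphere_bijective {n : ℕ} (hn : 1 ≤ n) :
    Function.Bijective (classDegree (pinchMap 0) (n := n)) :=
  classDegree_homeomorph_bijective pinchHomeomorph hn

/-! ### The cell structure of the lens space -/

/-- The point `e^{2πit/p}` of the circle. -/
noncomputable def lensExp (p : ℕ) (t : ℝ) : ℂ := Complex.exp (2 * Real.pi * Complex.I * t / p)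

theorem continuous_lensExp (p : ℕ) : Continuous (lensExp p) := by
  unfold lensExp
  fun_prop

theorem lensExp_add (p : ℕ) (s t : ℝ) : lensExp p (s + t) = lensExp p s * lensExp p t := by
  rw [lensExp, lensExp, lensExp, ← Complex.exp_add, Complex.ofReal_add, mul_add, add_div]

theorem lensExp_zero (p : ℕ) : lensExp p 0 = 1 := by
  rw [lensExp, Complex.ofReal_zero, mul_zero, zero_div, Complex.exp_zero]

theorem norm_lensExp (p : ℕ) (t : ℝ) : ‖lensExp p t‖ = 1 := by
  have h : 2 * Real.pi * Complex.I * t / p = ((2 * Real.pi * t / p : ℝ) : ℂ) * Complex.I := by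
    push_cast
    ring
  rw [lensExp, h, Complex.norm_exp_ofReal_mul_I]

theorem lensExp_nat_mul (p m : ℕ) (t : ℝ) : lensExp p (m * t) = lensExp p t ^ m := by
  rw [lensExp, lensExp, ← Complex.exp_nat_mul]
  push_cast
  ring_nf

theorem lensExp_eq_iff {p : ℕ} (hp : p ≠ 0) {s t : ℝ} :
    lensExp p s = lensExp p t ↔ ∃ m : ℤ, s = t + m * p := by
  have hp0 : (p : ℂ) ≠ 0 := Nat.cast_ne_zero.2 hp
  rw [lensExp, lensExp, Complex.exp_eq_exp_iff_exists_int]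
  refine exists_congr fun m => ?_
  rw [mul_div_assoc, mul_div_assoc, mul_comm (m : ℂ), ← mul_add,
    mul_right_inj' Complex.two_pi_I_ne_zero, div_eq_iff hp0, add_mul, div_mul_cancel₀ _ hp0]
  exact_mod_cast Iff.rfl

theorem lensExp_intCast_eq_iff {p : ℕ} (hp : p ≠ 0) {j k : ℤ} :
    lensExp p j = lensExp p k ↔ j ≡ k [ZMOD p] := by
  rw [lensExp_eq_iff hp, Int.modEq_comm, Int.modEq_iff_add_fac]
  refine exists_congr fun m => ?_
  rw [mul_comm]
  exact_mod_cast Iff.rfl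

theorem exists_eq_norm_mul_lensExp {p : ℕ} (hp : p ≠ 0) (z : ℂ) :
    ∃ t : ℝ, z = ‖z‖ * lensExp p t := by
  refine ⟨z.arg / (2 * Real.pi) * p, ?_⟩
  have hp0 : (p : ℂ) ≠ 0 := Nat.cast_ne_zero.2 hp
  have hpi : (Real.pi : ℂ) ≠ 0 := Complex.ofReal_ne_zero.2 Real.pi_ne_zero
  conv_lhs => rw [← Complex.norm_mul_exp_arg_mul_I z]
  rw [lensExp]
  congr 2
  push_cast
  field_simp

theorem exists_mul_modEq {a b : ℤ} (h : IsCoprime a b) (c : ℤ) : ∃ k, b * k ≡ c [ZMOD a] := by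
  obtain ⟨u, v, huv⟩ := h
  exact ⟨v * c, Int.modEq_iff_dvd.2 ⟨u * c, by linear_combination -c * huv⟩⟩

theorem SphereThree.norm_sq_add_norm_sq (x : SphereThree) : ‖x.1 0‖ ^ 2 + ‖x.1 1‖ ^ 2 = 1 := by
  have h := mem_sphere_zero_iff_norm.1 x.2
  rwa [EuclideanSpace.norm_eq, Real.sqrt_eq_one, Fin.sum_univ_two] at h

/-- The action of `k` on `S³`, whose orbits are the points of `L(p, q)`. -/
noncomputable def lensRotation (p : ℕ) (q k : ℤ) : C(SphereThree, SphereThree) where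
  toFun x := ⟨!₂[lensExp p k * x.1 0, lensExp p (q * k : ℤ) * x.1 1], by
    simpa [EuclideanSpace.norm_eq, norm_lensExp] using x.norm_sq_add_norm_sq⟩
  continuous_toFun := by
    refine Continuous.subtype_mk ?_ _
    refine (PiLp.continuous_toLp 2 _).comp (continuous_pi fun i => ?_)
    fin_cases i
    · change Continuous fun x : SphereThree => lensExp p k * x.1 0
      fun_prop
    · change Continuous fun x : SphereThree => lensExp p (q * k : ℤ) * x.1 1
      fun_prop

theorem sphereThree_ext {x y : SphereThree} (h0 : x.1 0 = y.1 0) (h1 : x.1 1 = y.1 1) : x = y := by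
  ext i
  fin_cases i
  exacts [h0, h1]

theorem lensRotation_eq_of_modEq {p : ℕ} (hp : p ≠ 0) {q j k : ℤ} (h : j ≡ k [ZMOD p]) :
    lensRotation p q j = lensRotation p q k := by
  ext1 x
  refine sphereThree_ext (congrArg (· * x.1 0) ((lensExp_intCast_eq_iff hp).2 h))
    (congrArg (· * x.1 1) ((lensExp_intCast_eq_iff hp).2 (h.mul_left q)))

/-- The quotient map from the sphere to the lens space. -/
def lensMk (p : ℕ) (q : ℤ) : C(SphereThree, LensSpace p q) :=
  ⟨Quotient.mk _, continuous_quotient_mk'⟩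

theorem lensMk_eq_iff {p : ℕ} {q : ℤ} {x y : SphereThree} :
    lensMk p q x = lensMk p q y ↔ ∃ k : ℤ, lensRotation p q k x = y := by
  refine Quotient.eq.trans (exists_congr fun k => ⟨fun ⟨h0, h1⟩ => ?_, fun h => h ▸ ⟨?_, ?_⟩⟩)
  · refine sphereThree_ext (h0.trans ?_).symm (h1.trans ?_).symm <;>
      simp [lensRotation, lensExp]
  all_goals simp [lensRotation, lensExp]

theorem isOpenQuotientMap_lensMk (p : ℕ) (q : ℤ) : IsOpenQuotientMap (lensMk p q) := by
  refine ⟨Quotient.mk_surjective, (lensMk p q).continuous, fun U hU => ?_⟩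
  refine isQuotientMap_quotient_mk'.isOpen_preimage.1 ?_
  have h : lensMk p q ⁻¹' (lensMk p q '' U) = ⋃ k : ℤ, lensRotation p q k ⁻¹' U := by
    ext x
    simp only [Set.mem_preimage, Set.mem_image, Set.mem_iUnion, eq_comm (b := lensMk p q x),
      lensMk_eq_iff]
    exact ⟨fun ⟨_, hy, k, hk⟩ => ⟨k, hk ▸ hy⟩, fun ⟨k, hk⟩ => ⟨_, hk, k, rfl⟩⟩
  exact h ▸ isOpen_iUnion fun k => hU.preimage (lensRotation p q k).continuous

theorem lensSpace_t2Space {p : ℕ} (hp : p ≠ 0) (q : ℤ) : T2Space (LensSpace p q) := by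
  refine (t2Space_iff_of_isOpenQuotientMap (isOpenQuotientMap_lensMk p q)).2 ?_
  have h : {x : SphereThree × SphereThree | lensMk p q x.1 = lensMk p q x.2} =
      ⋃ k ∈ Finset.range p, {x | lensRotation p q k x.1 = x.2} := by
    ext x
    simp only [Set.mem_ofPred_eq, Set.mem_iUnion, lensMk_eq_iff, Finset.mem_range]
    refine ⟨fun ⟨k, hk⟩ => ?_, fun ⟨k, _, hk⟩ => ⟨k, hk⟩⟩
    have hp' : (p : ℤ) ≠ 0 := Nat.cast_ne_zero.2 hp
    have hmod : ((k % p).toNat : ℤ) = k % p := Int.toNat_of_nonneg (Int.emod_nonneg k hp')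
    refine ⟨(k % p).toNat, by have := Int.emod_lt_of_pos k (b := p) (by lia); lia, ?_⟩
    rw [hmod, lensRotation_eq_of_modEq hp (Int.mod_modEq k p), hk]
  exact h ▸ isClosed_biUnion_finset fun k _ =>
    isClosed_eq ((lensRotation p q k).continuous.comp continuous_fst) continuous_snd

/-- The cylinder, which parametrizes the top cell of the lens space. -/
abbrev Cyl : Type := DiscTwo × I

/-- The boundary of the cylinder: its side, bottom and top. -/
def cylBoundary : Set Cyl := {x | ‖x.1.1‖ = 1 ∨ x.2 = 0 ∨ x.2 = 1}

theorem isClosed_cylBoundary : IsClosed cylBoundary :=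
  (isClosed_eq (by fun_prop) continuous_const).union
    ((isClosed_eq (by fun_prop) continuous_const).union
      (isClosed_eq (by fun_prop) continuous_const))

/-- The map `(z, s) ↦ (z, √(1 - |z|²) e^{2πis/p})`, whose image is a fundamental domain for the
action on `S³`. -/
noncomputable def cylToSphere (p : ℕ) : C(Cyl, SphereThree) where
  toFun x := ⟨!₂[x.1.1, (Real.sqrt (1 - ‖x.1.1‖ ^ 2) : ℂ) * lensExp p x.2], by
    simp [EuclideanSpace.norm_eq, DiscTwo.sq_sqrt, norm_lensExp]⟩
  continuous_toFun := by
    refine Continuous.subtype_mk ?_ _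
    refine (PiLp.continuous_toLp 2 _).comp (continuous_pi fun i => ?_)
    have := continuous_lensExp p
    fin_cases i
    · exact continuous_subtype_val.comp continuous_fst
    · change Continuous fun x : Cyl => (Real.sqrt (1 - ‖x.1.1‖ ^ 2) : ℂ) * lensExp p x.2
      fun_prop

theorem DiscTwo.ofReal_sqrt_ne_zero {z : DiscTwo} (hz : ‖z.1‖ ≠ 1) :
    (Real.sqrt (1 - ‖z.1‖ ^ 2) : ℂ) ≠ 0 :=
  Complex.ofReal_ne_zero.2 (Real.sqrt_ne_zero'.2
    (by nlinarith [norm_nonneg z.1, lt_of_le_of_ne z.norm_le hz]))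

theorem lensRotation_cylToSphere_eq_iff {p : ℕ} {q k : ℤ} {x y : Cyl} :
    lensRotation p q k (cylToSphere p x) = cylToSphere p y ↔ y.1.1 = lensExp p k * x.1.1 ∧
      (‖x.1.1‖ = 1 ∨ lensExp p y.2 = lensExp p ((q * k : ℤ) + x.2)) := by
  have hcoord : lensRotation p q k (cylToSphere p x) = cylToSphere p y ↔
      lensExp p k * x.1.1 = y.1.1 ∧ lensExp p (q * k : ℤ) *
        ((Real.sqrt (1 - ‖x.1.1‖ ^ 2) : ℂ) * lensExp p x.2) =
          (Real.sqrt (1 - ‖y.1.1‖ ^ 2) : ℂ) * lensExp p y.2 :=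
    ⟨fun h => ⟨congrArg (fun x : SphereThree => x.1 0) h,
      congrArg (fun x : SphereThree => x.1 1) h⟩, fun h => sphereThree_ext h.1 h.2⟩
  rw [hcoord, eq_comm (a := y.1.1)]
  refine and_congr_right fun h => ?_
  rw [← h, norm_mul, norm_lensExp, one_mul, mul_left_comm, ← lensExp_add, mul_eq_mul_left_iff,
    or_comm, eq_comm (a := lensExp p y.2)]
  refine or_congr_left ⟨not_imp_not.1 DiscTwo.ofReal_sqrt_ne_zero, fun h1 => ?_⟩
  rw [h1, one_pow, sub_self, Real.sqrt_zero, Complex.ofReal_zero]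

/-- The characteristic map of the top cell of the lens space. -/
noncomputable def lensCell (p : ℕ) (q : ℤ) : C(Cyl, LensSpace p q) :=
  (lensMk p q).comp (cylToSphere p)

theorem lensCell_eq_iff {p : ℕ} (hp : p ≠ 0) {q : ℤ} {x y : Cyl} :
    lensCell p q x = lensCell p q y ↔ ∃ k : ℤ, y.1.1 = lensExp p k * x.1.1 ∧
      (‖x.1.1‖ = 1 ∨ ∃ m : ℤ, m ≡ q * k [ZMOD p] ∧ (y.2 : ℝ) - x.2 = m) := by
  refine lensMk_eq_iff.trans (exists_congr fun k => lensRotation_cylToSphere_eq_iff.trans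
    (and_congr_right fun _ => or_congr_right ?_))
  rw [lensExp_eq_iff hp]
  constructor
  · rintro ⟨m, hm⟩
    refine ⟨q * k + p * m, Int.modEq_iff_dvd.2 ⟨-m, by ring⟩, ?_⟩
    rw [hm]
    push_cast
    ring
  · rintro ⟨m, hmod, hm⟩
    obtain ⟨l, hl⟩ := Int.modEq_iff_dvd.1 hmod.symm
    refine ⟨l, ?_⟩
    rw [sub_eq_iff_eq_add.1 hm, eq_add_of_sub_eq' hl]
    push_cast
    ring

theorem lensExp_eq_one_of_modEq_mul {p : ℕ} {q k : ℤ} (hp : p ≠ 0) (hq : IsCoprime (p : ℤ) q)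
    (h : 0 ≡ q * k [ZMOD p]) : lensExp p k = 1 := by
  have hk : k ≡ 0 [ZMOD p] :=
    Int.modEq_zero_iff_dvd.2 (hq.dvd_of_dvd_mul_left (Int.modEq_zero_iff_dvd.1 h.symm))
  rw [(lensExp_intCast_eq_iff hp).2 hk, Int.cast_zero, lensExp_zero]

theorem eq_or_mem_of_lensCell_eq {p : ℕ} {q : ℤ} (hp : p ≠ 0) (hq : IsCoprime (p : ℤ) q) {x y : Cyl}
    (h : lensCell p q x = lensCell p q y) : x = y ∨ (x ∈ cylBoundary ∧ y ∈ cylBoundary) := by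
  obtain ⟨k, hk, hx | ⟨m, hmod, hm⟩⟩ := (lensCell_eq_iff hp).1 h
  · exact Or.inr ⟨Or.inl hx, Or.inl (by rw [hk, norm_mul, norm_lensExp, hx, one_mul])⟩
  obtain ⟨hx0, hx1⟩ := x.2.2
  obtain ⟨hy0, hy1⟩ := y.2.2
  have hlow : -1 ≤ m := by exact_mod_cast (by linarith : (-1 : ℝ) ≤ m)
  have hupp : m ≤ 1 := by exact_mod_cast (by linarith : (m : ℝ) ≤ 1)
  obtain rfl | rfl | rfl : m = -1 ∨ m = 0 ∨ m = 1 := by lia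
  all_goals push_cast at hm
  · exact Or.inr ⟨Or.inr (Or.inr (Subtype.ext (by push_cast; linarith))),
      Or.inr (Or.inl (Subtype.ext (by push_cast; linarith)))⟩
  · left
    rw [lensExp_eq_one_of_modEq_mul hp hq hmod, one_mul] at hk
    exact Prod.ext (Subtype.ext hk.symm) (Subtype.ext (sub_eq_zero.1 hm).symm)
  · exact Or.inr ⟨Or.inr (Or.inl (Subtype.ext (by push_cast; linarith))),
      Or.inr (Or.inr (Subtype.ext (by push_cast; linarith)))⟩

theorem lensCell_surjective {p : ℕ} {q : ℤ} (hp : p ≠ 0) (hq : IsCoprime (p : ℤ) q) :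
    Function.Surjective (lensCell p q) := by
  intro y
  obtain ⟨y, rfl⟩ := (isOpenQuotientMap_lensMk p q).surjective y
  have hnorm := y.norm_sq_add_norm_sq
  obtain ⟨t, ht⟩ := exists_eq_norm_mul_lensExp hp (y.1 1)
  obtain ⟨k, hk⟩ := exists_mul_modEq hq (-⌊t⌋)
  have hz : ‖lensExp p k * y.1 0‖ = ‖y.1 0‖ := by rw [norm_mul, norm_lensExp, one_mul]
  have hz1 : ‖lensExp p k * y.1 0‖ ≤ 1 := by
    rw [hz]
    nlinarith [norm_nonneg (y.1 0), sq_nonneg ‖y.1 1‖]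
  refine ⟨(⟨lensExp p k * y.1 0, mem_closedBall_zero_iff.2 hz1⟩,
    ⟨Int.fract t, Int.fract_nonneg _, (Int.fract_lt_one _).le⟩),
    Eq.symm (lensMk_eq_iff.2 ⟨k, sphereThree_ext rfl ?_⟩)⟩
  change lensExp p (q * k : ℤ) * y.1 1 =
    (Real.sqrt (1 - ‖lensExp p k * y.1 0‖ ^ 2) : ℂ) * lensExp p (Int.fract t)
  rw [hz, ← eq_sub_of_add_eq' hnorm, Real.sqrt_sq (norm_nonneg _),
    (lensExp_intCast_eq_iff hp).2 hk]
  conv_lhs => rw [ht]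
  rw [mul_left_comm, ← lensExp_add, Int.cast_neg, neg_add_eq_sub, Int.self_sub_floor]

theorem isQuotientMap_lensCell {p : ℕ} {q : ℤ} (hp : p ≠ 0) (hq : IsCoprime (p : ℤ) q) :
    Topology.IsQuotientMap (lensCell p q) :=
  have := lensSpace_t2Space hp q
  (lensCell p q).continuous.isClosedMap.isQuotientMap (lensCell p q).continuous
    (lensCell_surjective hp hq)

theorem skeletonIncl_mooreMk {p : ℕ} {q : ℤ} (hp : 2 ≤ p) (z : DiscTwo) :
    skeletonIncl p q hp (mooreMk p z) = lensCell p q (z, 0) := by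
  refine congrArg (lensMk p q) (sphereThree_ext rfl ?_)
  change (Real.sqrt (1 - ‖z.1‖ ^ 2) : ℂ) = Real.sqrt (1 - ‖z.1‖ ^ 2) * lensExp p 0
  rw [lensExp_zero, mul_one]

theorem lensExp_intCast_pow {p : ℕ} (hp : p ≠ 0) (k : ℤ) : lensExp p k ^ p = 1 := by
  rw [← lensExp_nat_mul, ← lensExp_zero p, lensExp_eq_iff hp]
  exact ⟨k, by ring⟩

theorem skeletonIncl_injective {p : ℕ} {q : ℤ} (hp : 2 ≤ p) (hq : IsCoprime (p : ℤ) q) :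
    Function.Injective (skeletonIncl p q hp) := by
  have hp0 : p ≠ 0 := by lia
  intro x y
  refine Quotient.inductionOn₂ x y fun z w h => ?_
  replace h : lensCell p q (z, 0) = lensCell p q (w, 0) :=
    (skeletonIncl_mooreMk hp z).symm.trans (h.trans (skeletonIncl_mooreMk hp w))
  obtain ⟨k, hk, hz | ⟨m, hmod, hm⟩⟩ := (lensCell_eq_iff hp0).1 h
  · replace hk : w.1 = lensExp p k * z.1 := hk
    have hw : ‖w.1‖ = 1 := by rw [hk, norm_mul, norm_lensExp, one_mul, hz]
    refine Quotient.sound (Or.inr ⟨hz, hw, ?_⟩)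
    rw [hk, mul_pow, lensExp_intCast_pow hp0, one_mul]
  · obtain rfl : m = 0 := by exact_mod_cast hm.symm.trans (sub_self _)
    rw [lensExp_eq_one_of_modEq_mul hp0 hq hmod, one_mul] at hk
    exact congrArg (mooreMk p) (Subtype.ext hk.symm)

theorem exists_skeletonIncl_eq_lensCell {p : ℕ} {q : ℤ} (hp : 2 ≤ p) (hq : IsCoprime (p : ℤ) q)
    {x : Cyl} (hx : x ∈ cylBoundary) : ∃ y, skeletonIncl p q hp y = lensCell p q x := by
  have hp0 : p ≠ 0 := by lia
  obtain ⟨z, s⟩ := x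
  rcases hx with hz | rfl | rfl
  · refine ⟨mooreMk p z, (skeletonIncl_mooreMk hp z).trans ((lensCell_eq_iff hp0).2 ?_)⟩
    exact ⟨0, by rw [Int.cast_zero, lensExp_zero, one_mul], Or.inl hz⟩
  · exact ⟨mooreMk p z, skeletonIncl_mooreMk hp z⟩
  · obtain ⟨k, hk⟩ := exists_mul_modEq hq (-1)
    have hz : ‖lensExp p k * z.1‖ ≤ 1 := by
      rw [norm_mul, norm_lensExp, one_mul]
      exact z.norm_le
    refine ⟨mooreMk p ⟨lensExp p k * z.1, mem_closedBall_zero_iff.2 hz⟩,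
      (skeletonIncl_mooreMk hp _).trans (Eq.symm ((lensCell_eq_iff hp0).2
        ⟨k, rfl, Or.inr ⟨-1, hk.symm, ?_⟩⟩))⟩
    push_cast
    ring

theorem exists_attaching_map {p : ℕ} {q : ℤ} (hp : 2 ≤ p) (hq : IsCoprime (p : ℤ) q) :
    ∃ r : C(cylBoundary, MooreSpace p), ∀ x, skeletonIncl p q hp (r x) = lensCell p q x := by
  have := lensSpace_t2Space (p := p) (by lia) q
  have hemb : Topology.IsClosedEmbedding (skeletonIncl p q hp) :=
    (skeletonIncl p q hp).continuous.isClosedEmbedding (skeletonIncl_injective hp hq)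
  choose r hr using fun x : cylBoundary => exists_skeletonIncl_eq_lensCell hp hq x.2
  refine ⟨⟨r, hemb.isEmbedding.continuous_iff.2 ?_⟩, hr⟩
  rw [show skeletonIncl p q hp ∘ r = fun x : cylBoundary => lensCell p q x from funext hr]
  fun_prop

/-! ### Bundles on the lens space -/

/-- The factor by which the point `x` of the cylinder has to be divided, with `(0, 2)` as the
origin, in order to land on the side or on the bottom. -/
noncomputable def cylScale (x : Cyl) : ℝ := max ‖x.1.1‖ (1 - (x.2 : ℝ) / 2)

theorem cylScale_pos (x : Cyl) : 0 < cylScale x := lt_max_of_lt_right (by linarith [x.2.2.2])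

theorem cylScale_le (x : Cyl) : cylScale x ≤ 2 - x.2 :=
  max_le (by linarith [x.1.norm_le, x.2.2.2]) (by linarith [x.2.2.2])

/-- The retraction of the cylinder onto its bottom and side, by projection from the point `(0, 2)`
above it. -/
noncomputable def cylRetract : C(Cyl, Cyl) where
  toFun x := (⟨x.1.1 / (cylScale x : ℂ), by
      rw [mem_closedBall_zero_iff, norm_div, Complex.norm_of_nonneg (cylScale_pos x).le,
        div_le_one (cylScale_pos x)]
      exact le_max_left _ _⟩,
    ⟨2 - (2 - x.2) / cylScale x, by
      constructor
      · rw [sub_nonneg, div_le_iff₀ (cylScale_pos x)]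
        have hle : 1 - (x.2 : ℝ) / 2 ≤ cylScale x := le_max_right _ _
        linarith
      · rw [sub_le_comm, le_div_iff₀ (cylScale_pos x)]
        linarith [cylScale_le x]⟩)
  continuous_toFun := by
    have hc : Continuous cylScale := by
      unfold cylScale
      fun_prop
    refine Continuous.prodMk (Continuous.subtype_mk ?_ _) (Continuous.subtype_mk ?_ _)
    · exact Continuous.div (by fun_prop) (by fun_prop) fun x =>
        Complex.ofReal_ne_zero.2 (cylScale_pos x).ne'
    · exact continuous_const.sub (Continuous.div (by fun_prop) hc fun x => (cylScale_pos x).ne')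

theorem norm_cylRetract_eq_one_or (x : Cyl) :
    ‖(cylRetract x).1.1‖ = 1 ∨ (cylRetract x).2 = 0 := by
  have hpos := cylScale_pos x
  rcases le_total (1 - (x.2 : ℝ) / 2) ‖x.1.1‖ with h | h
  · left
    have hscale : cylScale x = ‖x.1.1‖ := max_eq_left h
    change ‖x.1.1 / (cylScale x : ℂ)‖ = 1
    rw [norm_div, Complex.norm_of_nonneg hpos.le, ← hscale, div_self hpos.ne']
  · right
    have hscale : cylScale x = 1 - (x.2 : ℝ) / 2 := max_eq_right h
    refine Subtype.ext ?_
    change 2 - (2 - (x.2 : ℝ)) / cylScale x = 0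
    rw [sub_eq_zero, eq_div_iff hpos.ne', hscale]
    ring

theorem cylRetract_eq {x : Cyl} (hx : ‖x.1.1‖ = 1 ∨ x.2 = 0) : cylRetract x = x := by
  have h1 : cylScale x = 1 := by
    rcases hx with hx | hx
    · exact (max_eq_left (by linarith [x.2.2.1])).trans hx
    · rw [cylScale, hx]
      simpa using x.1.norm_le
  refine Prod.ext (Subtype.ext ?_) (Subtype.ext ?_)
  · change x.1.1 / (cylScale x : ℂ) = x.1.1
    rw [h1, Complex.ofReal_one, div_one]
  · change 2 - (2 - (x.2 : ℝ)) / cylScale x = x.2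
    rw [h1]
    ring

theorem exists_log_side_bottom (a : C(cylBoundary, ℂ)) (ha : ∀ x, a x ≠ 0) :
    ∃ l : C(Cyl, ℂ), ∀ x : cylBoundary, (‖x.1.1.1‖ = 1 ∨ x.1.2 = 0) →
      Complex.exp (l x) = a x := by
  let r : C(Cyl, cylBoundary) :=
    ⟨fun x => ⟨cylRetract x, (norm_cylRetract_eq_one_or x).imp_right Or.inl⟩, by fun_prop⟩
  obtain ⟨l, hl⟩ := exists_log (a.comp r) fun _ => ha _
  exact ⟨l, fun x hx => (hl x).trans (congrArg a (Subtype.ext (cylRetract_eq hx)))⟩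

theorem exists_log_eq_zero_on_circle (g : C(DiscTwo, ℂ)) (hg : ∀ z, g z ≠ 0)
    (hg1 : ∀ z, g (circleToDisc z) = 1) :
    ∃ m : C(DiscTwo, ℂ), (∀ z, Complex.exp (m z) = g z) ∧ ∀ z, m (circleToDisc z) = 0 := by
  obtain ⟨m, hm⟩ := exists_log g hg
  have hm1 (z) : Complex.exp (m (circleToDisc z)) = 1 := (hm _).trans (hg1 z)
  have hconst := eq_of_exp_eq (a := fun z => m (circleToDisc z)) (b := fun _ => m (circleToDisc 1))
    (by fun_prop) continuous_const (fun z => (hm1 z).trans (hm1 1).symm) (y₀ := 1) rfl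
  refine ⟨⟨fun z => m z - m (circleToDisc 1), by fun_prop⟩, fun z => ?_,
    fun z => sub_eq_zero.2 (congrFun hconst z)⟩
  change Complex.exp (m z - m (circleToDisc 1)) = g z
  rw [Complex.exp_sub, hm, hm1, div_one]

theorem exists_cyl_extension (a : C(cylBoundary, ℂ)) (ha : ∀ x, a x ≠ 0) :
    ∃ b : C(Cyl, ℂ), (∀ x, b x ≠ 0) ∧ ∀ x : cylBoundary, b x = a x := by
  obtain ⟨l, hl⟩ := exists_log_side_bottom a ha
  let top : C(DiscTwo, cylBoundary) := ⟨fun z => ⟨(z, 1), Or.inr (Or.inr rfl)⟩, by fun_prop⟩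
  -- The logarithm `l` of `a` is corrected on the top by `m`, which vanishes on its boundary circle.
  obtain ⟨m, hm, hm0⟩ := exists_log_eq_zero_on_circle
    ⟨fun z => a (top z) / Complex.exp (l (top z)), by fun_prop (disch := simp)⟩
    (fun z => div_ne_zero (ha _) (Complex.exp_ne_zero _))
    fun z => (div_eq_one_iff_eq (Complex.exp_ne_zero _)).2
      (hl (top (circleToDisc z)) (Or.inl (Circle.norm_coe z))).symm
  refine ⟨⟨fun x => Complex.exp (l x + (x.2 : ℝ) * m x.1), by fun_prop⟩,
    fun _ => Complex.exp_ne_zero _, ?_⟩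
  rintro ⟨⟨z, s⟩, h | h | h⟩
  · have hmz : m z = 0 := hm0 (discBoundaryToCircle ⟨z, h⟩)
    rw [← hl _ (Or.inl h)]
    change Complex.exp (l (z, s) + (s : ℝ) * m z) = _
    rw [hmz, mul_zero, add_zero]
  · obtain rfl : s = 0 := h
    rw [← hl _ (Or.inr rfl)]
    change Complex.exp (l (z, 0) + ((0 : I) : ℝ) * m z) = Complex.exp (l (z, 0))
    rw [Set.Icc.coe_zero, Complex.ofReal_zero, zero_mul, add_zero]
  · obtain rfl : s = 1 := h
    change Complex.exp (l (z, 1) + ((1 : I) : ℝ) * m z) = a (top z)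
    rw [Set.Icc.coe_one, Complex.ofReal_one, one_mul, Complex.exp_add, hm]
    exact mul_div_cancel₀ _ (Complex.exp_ne_zero _)

section Lens

variable {p n : ℕ} {q : ℤ}

theorem bundleIso_of_skeletonIncl (hp : 2 ≤ p) (hq : IsCoprime (p : ℤ) q)
    {f f' : C(LensSpace p q, BU 1)}
    (h : BundleIso (f.comp (skeletonIncl p q hp)) (f'.comp (skeletonIncl p q hp))) :
    BundleIso f f' := by
  have hp0 : p ≠ 0 := by lia
  obtain ⟨T, hT⟩ := h
  obtain ⟨r, hr⟩ := exists_attaching_map hp hq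
  obtain ⟨F, hF⟩ := exists_frame (f.comp (lensCell p q))
  obtain ⟨F', hF'⟩ := exists_frame (f'.comp (lensCell p q))
  have hTF (x : cylBoundary) :
      T (r x) (F x 0) ∈ (f' (lensCell p q x)).1.range ∧ T (r x) (F x 0) ≠ 0 := by
    have hFx : F x 0 ∈ (f (skeletonIncl p q hp (r x))).1.range := (hr x).symm ▸ (hF x).1 0
    obtain ⟨hmem, hinj⟩ := hT (r x) (F x 0) hFx
    exact ⟨hr x ▸ hmem, fun h0 => (hF x).2.ne_zero 0 (hinj h0)⟩
  obtain ⟨a, ha⟩ := exists_continuous_coords (𝕜 := ℂ) (F := fun x : cylBoundary => F' x)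
    (by fun_prop) (fun x => (hF' x).2) (s := fun x => T (r x) (F x 0)) (by fun_prop)
    fun x => (hF' x).span_eq ▸ (hTF x).1
  simp only [Fin.sum_univ_one] at ha
  obtain ⟨b, hb0, hba⟩ := exists_cyl_extension ⟨fun x => a x 0, by fun_prop⟩ fun x hx =>
    (hTF x).2 ((ha x).trans (by rw [show a x 0 = 0 from hx, zero_smul]))
  refine bundleIso_of_sections (isQuotientMap_lensCell hp0 hq)
    (fun _ _ => eq_or_mem_of_lensCell_eq hp0 hq) (F := ⟨fun x => F x 0, by fun_prop⟩)
    (F' := ⟨fun x => b x • F' x 0, by fun_prop⟩) (T := fun x => T (r x))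
    (fun x => (hF x).1 0) (fun x => (hF x).2.ne_zero 0)
    (fun x => Submodule.smul_mem _ _ ((hF' x).1 0))
    (fun x => smul_ne_zero (hb0 x) ((hF' x).2.ne_zero 0))
    (fun x => (ha x).trans (congrArg (· • F' x 0) (hba x).symm))
    fun x y hxy => congrArg T (skeletonIncl_injective hp hq ?_)
  rw [hr, hr, hxy]

theorem exists_section_lens (hp : 2 ≤ p) (hq : IsCoprime (p : ℤ) q) (hn : 2 ≤ n)
    (f : C(LensSpace p q, BU n)) :
    ∃ S : C(LensSpace p q, EllTwo), (∀ x, S x ∈ (f x).1.range) ∧ ∀ x, S x ≠ 0 := by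
  have hp0 : p ≠ 0 := by lia
  obtain ⟨s, hs, hs0⟩ := exists_section_moore hn (f.comp (skeletonIncl p q hp))
  obtain ⟨r, hr⟩ := exists_attaching_map hp hq
  have hcoord : Function.Injective fun x : Cyl => (x.1.1, (x.2 : ℝ)) :=
    Subtype.val_injective.prodMap Subtype.val_injective
  obtain ⟨S, hS, hS0, -⟩ := exists_section_extension ⟨_, by fun_prop⟩ hcoord
    (isQuotientMap_lensCell hp0 hq) isClosed_cylBoundary
    (fun _ _ => eq_or_mem_of_lensCell_eq hp0 hq)
    (by rw [Module.finrank_prod, Complex.finrank_real_complex, Module.finrank_self]; lia) f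
    (s.comp r) (fun x => hr x ▸ hs (r x)) (fun _ => hs0 _)
    fun x y hxy => congrArg s (skeletonIncl_injective hp hq ((hr x).trans (hxy.trans (hr y).symm)))
  exact ⟨S, hS, hS0⟩

theorem homotopic_of_mooreDegree_skeletonIncl_eq (hp : 2 ≤ p) (hq : IsCoprime (p : ℤ) q)
    (hn : 1 ≤ n) {f f' : C(LensSpace p q, BU n)}
    (h : mooreDegree (f.comp (skeletonIncl p q hp)) = mooreDegree (f'.comp (skeletonIncl p q hp))) :
    Homotopic f f' := by
  induction n, hn using Nat.le_induction with
  | base => exact (bundleIso_of_skeletonIncl hp hq (bundleIso_of_mooreDegree_eq h)).homotopic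
  | succ n hn ih =>
    obtain ⟨s, hs, hs0⟩ := exists_section_lens hp hq (by lia) f
    obtain ⟨s', hs', hs0'⟩ := exists_section_lens hp hq (by lia) f'
    obtain ⟨g, hg⟩ := exists_bundleSum_of_section f s hs hs0
    obtain ⟨g', hg'⟩ := exists_bundleSum_of_section f' s' hs' hs0'
    have hsum (g : C(LensSpace p q, BU n)) :
        mooreDegree ((bundleSum g (trivialBundle _ 1)).comp (skeletonIncl p q hp)) =
          mooreDegree (g.comp (skeletonIncl p q hp)) + mooreDegree (trivialBundle _ 1) :=
      mooreDegree_bundleSum (g.comp (skeletonIncl p q hp)) (trivialBundle _ 1)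
    rw [← (hg.comp _).mooreDegree_eq, ← (hg'.comp _).mooreDegree_eq, hsum, hsum] at h
    refine (hg.homotopic.symm.trans ?_).trans hg'.homotopic
    exact Homotopic.comp (Homotopic.refl _) ((ih (add_right_cancel h)).prodMk (Homotopic.refl _))

/-- The point of the disc which is obtained from `(z, s)` by undoing `r` times the rotation of the
second coordinate in the cell `(z, s) ↦ [(z, √(1 - |z|²) e^{2πis/p})]`. -/
noncomputable def untwist (p : ℕ) (r : ℤ) : C(Cyl, DiscTwo) where
  toFun x := ⟨lensExp p (-(r * x.2)) * x.1.1, by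
    rw [mem_closedBall_zero_iff, norm_mul, norm_lensExp, one_mul]
    exact x.1.norm_le⟩
  continuous_toFun := by
    have := continuous_lensExp p
    fun_prop

theorem discToSphereTwo_untwist_eq {r : ℤ} (hp : p ≠ 0) (hr : q * r ≡ 1 [ZMOD p]) {x y : Cyl}
    (h : lensCell p q x = lensCell p q y) :
    discToSphereTwo (untwist p r x) = discToSphereTwo (untwist p r y) := by
  have hnorm (x : Cyl) : ‖(untwist p r x).1‖ = ‖x.1.1‖ := by
    change ‖lensExp p _ * x.1.1‖ = _
    rw [norm_mul, norm_lensExp, one_mul]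
  obtain ⟨k, hk, hx | ⟨m, hmod, hm⟩⟩ := (lensCell_eq_iff hp).1 h
  · have hy : ‖y.1.1‖ = 1 := by rw [hk, norm_mul, norm_lensExp, one_mul, hx]
    simp [discToSphereTwo, hnorm, hx, hy]
  · have hkm : k ≡ r * m [ZMOD p] := by
      calc k ≡ q * r * k [ZMOD p] := by simpa using (hr.mul_right k).symm
        _ = r * (q * k) := by ring
        _ ≡ r * m [ZMOD p] := (hmod.mul_left r).symm
    refine congrArg discToSphereTwo (Subtype.ext ?_)
    change lensExp p _ * x.1.1 = lensExp p _ * y.1.1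
    rw [hk, ← mul_assoc, (lensExp_intCast_eq_iff hp).2 hkm, ← lensExp_add]
    congr 2
    push_cast
    rw [← hm]
    ring

theorem exists_pinch_extension (hp : 2 ≤ p) (hq : IsCoprime (p : ℤ) q) :
    ∃ πbar : C(LensSpace p q, SphereTwo), πbar.comp (skeletonIncl p q hp) = pinchMap p := by
  have hp0 : p ≠ 0 := by lia
  obtain ⟨r, hr⟩ := exists_mul_modEq hq 1
  have hquot := isQuotientMap_lensCell hp0 hq
  let g : C(Cyl, SphereTwo) := discToSphereTwo.comp (untwist p r)
  have hfac : Function.FactorsThrough g (lensCell p q) := fun x y h =>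
    discToSphereTwo_untwist_eq hp0 hr h
  refine ⟨hquot.lift g hfac, ContinuousMap.ext fun x => Quotient.inductionOn x fun z => ?_⟩
  have hz : untwist p r (z, 0) = z := Subtype.ext (by
    change lensExp p (-(r * ((0 : I) : ℝ))) * z.1 = z.1
    rw [Set.Icc.coe_zero, mul_zero, neg_zero, lensExp_zero, one_mul])
  calc hquot.lift g hfac (skeletonIncl p q hp (mooreMk p z))
      = hquot.lift g hfac (lensCell p q (z, 0)) := by rw [skeletonIncl_mooreMk]
    _ = g (z, 0) := congrArg (fun g : C(Cyl, SphereTwo) => g (z, 0)) (hquot.lift_comp g hfac)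
    _ = pinchMap p (mooreMk p z) := congrArg discToSphereTwo hz

theorem classDegree_lens_bijective (hp : 2 ≤ p) (hq : IsCoprime (p : ℤ) q) (hn : 1 ≤ n) :
    Function.Bijective (classDegree (skeletonIncl p q hp) (n := n)) := by
  constructor
  · intro α β h
    obtain ⟨f, rfl⟩ := htpyClass_surjective α
    obtain ⟨f', rfl⟩ := htpyClass_surjective β
    exact htpyClass_eq_iff.2 (homotopic_of_mooreDegree_skeletonIncl_eq hp hq hn h)
  · intro d
    obtain ⟨k, rfl⟩ := ZMod.intCast_surjective d
    obtain ⟨πbar, hπ⟩ := exists_pinch_extension hp hq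
    obtain ⟨α, hα⟩ := (classDegree_sphere_bijective hn).surjective (k : ZMod 0)
    obtain ⟨f, rfl⟩ := htpyClass_surjective α
    refine ⟨htpyClass (f.comp πbar), ?_⟩
    rw [classDegree_htpyClass, ContinuousMap.comp_assoc, hπ, mooreDegree_pinchMap]
    exact congrArg (fun k : ℤ => (k : ZMod p)) hα

end Lens

theorem lemma2p3 (n p : ℕ) (q : ℤ) (hn : 1 ≤ n) (hp : 2 ≤ p) (hq : IsCoprime (p : ℤ) q) :
    ∃ (_ : AddCommGroup (HtpyClasses SphereTwo (BU n)))
      (_ : AddCommGroup (HtpyClasses (MooreSpace p) (BU n)))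
      (_ : AddCommGroup (HtpyClasses (LensSpace p q) (BU n))),
      IsBundleGroup SphereTwo n ∧ IsBundleGroup (MooreSpace p) n ∧
      IsBundleGroup (LensSpace p q) n ∧
      ∃ (eS : HtpyClasses SphereTwo (BU n) ≃+ ℤ)
        (eP : HtpyClasses (MooreSpace p) (BU n) ≃+ ZMod p)
        (r : HtpyClasses (LensSpace p q) (BU n) ≃+ HtpyClasses (MooreSpace p) (BU n)),
        (∀ α, eP (htpyPullback (BU n) (pinchMap p) α) = (eS α : ZMod p)) ∧
        (∀ α, r α = htpyPullback (BU n) (skeletonIncl p q hp) α) ∧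
        (∃ πbar : C(LensSpace p q, SphereTwo), πbar.comp (skeletonIncl p q hp) = pinchMap p) ∧
        ∀ πbar : C(LensSpace p q, SphereTwo),
          (πbar.comp (skeletonIncl p q hp)).Homotopic (pinchMap p) →
          ∀ α, eP (r (htpyPullback (BU n) πbar α)) = (eS α : ZMod p) := by
  obtain ⟨gS, eS, hS, heS⟩ := exists_bundleGroup (pinchMap 0)
    (fun _ => classDegree_sphere_bijective) hn
  obtain ⟨gP, eP, hP, heP⟩ := exists_bundleGroup (ContinuousMap.id (MooreSpace p))
    (fun _ => classDegree_moore_bijective) hn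
  obtain ⟨gL, eL, hL, heL⟩ := exists_bundleGroup (skeletonIncl p q hp)
    (fun _ => classDegree_lens_bijective hp hq) hn
  have hpinch (α) : eP (htpyPullback (BU n) (pinchMap p) α) = Int.cast (eS α) := by
    obtain ⟨f, rfl⟩ := htpyClass_surjective α
    rw [heP, heS]
    exact mooreDegree_pinchMap f p
  have hr (α) : (eL.trans eP.symm) α = htpyPullback (BU n) (skeletonIncl p q hp) α := by
    rw [AddEquiv.trans_apply, AddEquiv.symm_apply_eq, heL, heP]
    obtain ⟨f, rfl⟩ := htpyClass_surjective α
    rfl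
  refine ⟨gS, gP, gL, hS, hP, hL, eS, eP, eL.trans eP.symm, hpinch, hr,
    exists_pinch_extension hp hq, fun πbar hπ α => ?_⟩
  refine (congrArg eP (hr _)).trans (Eq.trans ?_ (hpinch α))
  obtain ⟨f, rfl⟩ := htpyClass_surjective α
  exact congrArg eP (htpyClass_eq_iff.2 (Homotopic.comp (Homotopic.refl f) hπ))
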